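/- Notation. $\mathbb T=\mathbb R/\mathbb Z$; $|\cdot|$ is the supremum norm on $\mathbb R^2$ and $d$ the associated distance; $B_R=[-R,R]^2$. $C^r_1(B_R)$ and $C^r_1(\mathbb T^2)$ are the unit balls of the spaces of $C^r$ functions for the norm given by the supremum of the absolute values of all partial derivatives of order $\le r$. For $k\in\mathbb Z^2\setminus\{0\}$ and $f\in C^r_1(\mathbb T^2)$ put $\bar f_k(\theta)=\int_0^1 f(\theta+tk)\,dt$, and let $\mathcal G_k^r$ be the set of $f\in C^r_1(\mathbb T^2)$ with $\partial_\theta\bar f_k(\theta^*)\ne0$ for some $\theta^*\in\mathbb T^2$ (i.e. $\bar f_k$ is not constant). A solution of $H(\theta,I)=h(I)+\varepsilon f(\theta)$ is a curve $(\theta(t),I(t))$ in $\mathbb T^2\times B_R$ with $\dot\theta=\partial_IH$, $\dot I=-\partial_\theta H$. Closed segments have positive length. Conditions on $h:B_R\to\mathbb R$: (A.1) there are $k=(k_1,k_2)\in\mathbb Z^2\setminus\{0\}$, $a\in\mathbb R$ and a closed segment $S\subseteq L\cap B_R$, $L=\{k_1I_1+k_2I_2+a=0\}$, on which $h$ is constant;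 (A.2) there is a closed segment $S^*\subseteq S$ with $\nabla h(I)\neq0$ for all $I\in S^*$. **Theorem, part 1.** Let $h\in C^{10}_1(B_R)$ satisfy (A.1) and (A.2), where $S^*$ contains a point of the interior of $B_R$ (equivalently, $S^*$ is not contained in an edge of the square $B_R$), and let $f\in\mathcal G_k^{19}$. There is a constant $c>0$, depending on $h$ only through $R$, $k$, $a$, the length of $S^*$ and a positive lower bound of $|\nabla h|$ on $S^*$, and for every $\rho\ge 0$ there are constants $\varepsilon_0\in(0,1]$ and $\delta>0$, depending on these same data and also on $f$ and $\rho$, such that the following holds. For any two points $I',I''\in S^*$ with $|I'-I''|=\rho$ and any $0<\varepsilon\le\varepsilon_0$, the Hamiltonian system defined by $H=h+\varepsilon f$ has a solution $(\theta(t),I(t))$ on an interval $[0,\tau]$ with $0\le\tau\le\delta\varepsilon^{-1}$ such that $$|I(0)-I'|\le c\varepsilon,\qquad |I(\tau)-I''|\le c\varepsilon,\qquad d(I(t),S^*)\le c\varepsilon\ \text{ for all } t\in[0,\tau].$$ **Part 2.** Let $R,\ell,\varpi>0$. There is $c>0$, depending only on $R,\ell,\varpi$, and for all $\lambda>0$,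 $\rho\ge0$ there is $\varepsilon_0\in(0,1]$, depending only on $R,\ell,\varpi,\lambda,\rho$, such that the following holds. Let $h\in C^{10}_1(B_R)$ and let $S_1^*\subseteq S_1\subseteq[-R,R]$ be closed segments, $S_1^*$ of length $\ell$, with $\partial_{I_1}h(I_1,0)=0$ for $I_1\in S_1$ and $\partial_{I_2}h(I_1,0)\ge\varpi$ for $I_1\in S_1^*$. Let $f\in C^{19}_1(\mathbb T^2)$ and $\bar f(\theta_1)=\int_0^1 f(\theta_1,\theta_2)\,d\theta_2$. Let $I_1',I_1''\in S_1^*$ with $|I_1'-I_1''|=\rho$, and let $\theta_1^*$ satisfy $|\bar f'(\theta_1^*)|\ge\lambda$ and $\bar f'(\theta_1^*)\,(I_1''-I_1')\le0$. Then for any $0<\varepsilon\le\varepsilon_0$ the Hamiltonian system defined by $H=h+\varepsilon f$ has a solution $(\theta(t),I(t))$ on an interval $[0,\tau]$ with $0\le\tau\le 2\rho\lambda^{-1}\varepsilon^{-1}$ such that $$|I_1(0)-I_1'|\le c\varepsilon,\qquad |I_1(\tau)-I_1''|\le c\varepsilon,$$ and $|I_2(t)|\le c\varepsilon$, $d(I_1(t),S_1^*)\le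 c\varepsilon$ for all $t\in[0,\tau]$. -/

import Mathlib

namespace FastDrift

/-- `ℝ²` with the supremum norm; it carries the actions `I` and the lifts to `ℝ²` of the angles
`θ ∈ 𝕋² = ℝ²/ℤ²`. -/
abbrev Plane : Type := Fin 2 → ℝ

/-- The closed ball `B_R` of radius `R` about the origin for the supremum norm, i.e. the square
`[-R, R]²`. -/
def actionBall (R : ℝ) : Set Plane := Metric.closedBall 0 R

/-- The integer vector `k`, seen in `ℝ²`. -/
def toPlane (k : Fin 2 → ℤ) : Plane := fun i => (k i : ℝ)

/-- The unit ball of the space of real functions of class `C^r` on `s ⊆ ℝ²`, for the norm given by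
the supremum over `s` of the absolute values of all the partial derivatives of order at most `r`.
It is used for `s = B_R` and for `s = ℝ²`. -/
def unitBallC (r : ℕ) (s : Set Plane) : Set (Plane → ℝ) :=
  {g | ContDiffOn ℝ r g s ∧
    ∀ m : ℕ, m ≤ r → ∀ i : Fin m → Fin 2, ∀ x ∈ s,
      |iteratedFDerivWithin ℝ m g s x (fun l => Pi.single (i l) 1)| ≤ 1}

/-- The unit ball of `C^r(𝕋²)`; functions on the torus are `ℤ²`-periodic functions on `ℝ²`. -/
def unitBallTorus (r : ℕ) : Set (Plane → ℝ) :=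
  {f | f ∈ unitBallC r Set.univ ∧ ∀ (m : Fin 2 → ℤ) (θ : Plane), f (θ + toPlane m) = f θ}

/-- The average `θ ↦ ∫₀¹ f (θ + t k) dt` of `f` along `k`. -/
noncomputable def kAverage (k : Fin 2 → ℤ) (f : Plane → ℝ) (θ : Plane) : ℝ :=
  ∫ t in (0 : ℝ)..1, f (θ + t • toPlane k)

/-- The set `𝒢_k^r` of those `f` in the unit ball of `C^r(𝕋²)` whose `k`-average has a nonzero
derivative at some point. -/
def perturbations (k : Fin 2 → ℤ) (r : ℕ) : Set (Plane → ℝ) :=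
  {f | f ∈ unitBallTorus r ∧ ∃ θ : Plane, fderiv ℝ (kAverage k f) θ ≠ 0}

/-- The gradient of `h : B_R → ℝ`. -/
noncomputable def grad (R : ℝ) (h : Plane → ℝ) (I : Plane) : Plane :=
  fun i => fderivWithin ℝ h (actionBall R) I (Pi.single i 1)

/-- The line `k₁ I₁ + k₂ I₂ + a = 0`. -/
def resonantLine (k : Fin 2 → ℤ) (a : ℝ) : Set Plane :=
  {I | (k 0 : ℝ) * I 0 + (k 1 : ℝ) * I 1 + a = 0}

/-- Closed segments (of positive length) in the plane. -/
def IsClosedSegment (S : Set Plane) : Prop :=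
  ∃ p q : Plane, p ≠ q ∧ S = segment ℝ p q

/-- `S` is a closed segment contained in the line `k₁ I₁ + k₂ I₂ + a = 0` and in `B_R`, on which
`h` is constant. -/
def CondA1 (R : ℝ) (k : Fin 2 → ℤ) (a : ℝ) (h : Plane → ℝ) (S : Set Plane) : Prop :=
  k ≠ 0 ∧ IsClosedSegment S ∧ S ⊆ resonantLine k a ∩ actionBall R ∧ ∃ e : ℝ, ∀ I ∈ S, h I = e

/-- `Sstar ⊆ S` is a closed segment on which the gradient of `h` does not vanish. -/
def CondA2 (R : ℝ) (h : Plane → ℝ) (S Sstar : Set Plane) : Prop :=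
  IsClosedSegment Sstar ∧ Sstar ⊆ S ∧ ∀ I ∈ Sstar, grad R h I ≠ 0

/-- `(θ, I)` is, on the time interval `[0, τ]`, a solution in `𝕋² × B_R` of the Hamiltonian system
`θ̇ = ∂H/∂I`, `İ = -∂H/∂θ` (with the angles lifted to `ℝ²`). -/
structure IsSolution (R : ℝ) (H : Plane → Plane → ℝ) (τ : ℝ) (θ I : ℝ → Plane) : Prop where
  mem_ball : ∀ t ∈ Set.Icc 0 τ, I t ∈ actionBall R
  angle_eq : ∀ t ∈ Set.Icc 0 τ, ∀ i : Fin 2,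
    HasDerivWithinAt (fun s => θ s i)
      (fderivWithin ℝ (fun J => H (θ t) J) (actionBall R) (I t) (Pi.single i 1))
      (Set.Icc 0 τ) t
  action_eq : ∀ t ∈ Set.Icc 0 τ, ∀ i : Fin 2,
    HasDerivWithinAt (fun s => I s i)
      (-(fderiv ℝ (fun φ => H φ (I t)) (θ t) (Pi.single i 1)))
      (Set.Icc 0 τ) t

/-- The Hamiltonian `h(I) + ε f(θ)`. -/
def perturbed (h f : Plane → ℝ) (ε : ℝ) (θ I : Plane) : ℝ := h I + ε * f θ

/-- The average `x ↦ ∫₀¹ f(x, y) dy` over the second angle. -/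
noncomputable def avgSecond (f : Plane → ℝ) (x : ℝ) : ℝ :=
  ∫ y in (0 : ℝ)..1, f ![x, y]

/-- `[s₁, s₂] ⊆ [-R, R]` is a closed segment and the first component of the gradient of `h`
vanishes at `(x, 0)` for all `x ∈ [s₁, s₂]`. -/
def CondB1 (R : ℝ) (h : Plane → ℝ) (s₁ s₂ : ℝ) : Prop :=
  s₁ < s₂ ∧ Set.Icc s₁ s₂ ⊆ Set.Icc (-R) R ∧ ∀ x ∈ Set.Icc s₁ s₂, grad R h ![x, 0] 0 = 0

/-- `[t₁, t₂] ⊆ [s₁, s₂]` is a closed segment and the second component of the gradient of `h` is at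
least `w` at `(x, 0)` for all `x ∈ [t₁, t₂]`. -/
def CondB2 (R : ℝ) (h : Plane → ℝ) (s₁ s₂ t₁ t₂ w : ℝ) : Prop :=
  t₁ < t₂ ∧ Set.Icc t₁ t₂ ⊆ Set.Icc s₁ s₂ ∧ ∀ x ∈ Set.Icc t₁ t₂, w ≤ grad R h ![x, 0] 1

end FastDrift

set_option maxSynthPendingDepth 3

namespace FastDrift

open Set Filter Topology MeasureTheory

theorem norm_le_two_pow_of_single {m : ℕ} (A : ContinuousMultilinearMap ℝ (fun _ : Fin m => Plane) ℝ)
    (hA : ∀ i : Fin m → Fin 2, |A (fun l => Pi.single (i l) 1)| ≤ 1) : ‖A‖ ≤ 2 ^ m := by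
  refine A.opNorm_le_bound (by positivity) fun v => ?_
  have hv : v = fun l => ∑ j : Fin 2, v l j • (Pi.single j (1 : ℝ) : Plane) := by
    ext l i; simp [Finset.sum_apply, Pi.single_apply]
  have h1 : A v = ∑ i : Fin m → Fin 2, (∏ l, v l (i l)) * A (fun l => Pi.single (i l) 1) := by
    conv_lhs => rw [hv]
    rw [ContinuousMultilinearMap.map_sum]
    refine Finset.sum_congr rfl fun i _ => ?_
    rw [ContinuousMultilinearMap.map_smul_univ, smul_eq_mul]
  rw [h1]
  refine (norm_sum_le _ _).trans ?_
  have h2 : ∀ i ∈ (Finset.univ : Finset (Fin m → Fin 2)),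
      ‖(∏ l, v l (i l)) * A (fun l => Pi.single (i l) 1)‖ ≤ ∏ l, ‖v l‖ := by
    intro i _
    rw [norm_mul, norm_prod]
    calc _ ≤ (∏ l, ‖v l‖) * 1 := by
          refine mul_le_mul ?_ (hA i) (norm_nonneg _) (by positivity)
          exact Finset.prod_le_prod (fun _ _ => norm_nonneg _) fun l _ => norm_le_pi_norm (v l) (i l)
      _ = _ := mul_one _
  refine (Finset.sum_le_card_nsmul _ _ _ h2).trans ?_
  simp

/-- Three times continuously differentiable functions with the bounds coming from a unit ball. -/
structure HasJet (s : Set Plane) (h : Plane → ℝ) (H1 : Plane → Plane →L[ℝ] ℝ)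
    (H2 : Plane → Plane →L[ℝ] Plane →L[ℝ] ℝ)
    (H3 : Plane → Plane →L[ℝ] Plane →L[ℝ] Plane →L[ℝ] ℝ) : Prop where
  d1 : ∀ x ∈ s, HasFDerivWithinAt h (H1 x) s x
  d2 : ∀ x ∈ s, HasFDerivWithinAt H1 (H2 x) s x
  d3 : ∀ x ∈ s, HasFDerivWithinAt H2 (H3 x) s x
  b0 : ∀ x ∈ s, |h x| ≤ 1
  b1 : ∀ x ∈ s, ‖H1 x‖ ≤ 2
  b2 : ∀ x ∈ s, ‖H2 x‖ ≤ 4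
  b3 : ∀ x ∈ s, ‖H3 x‖ ≤ 8

theorem hasJet_of_unitBallC {r : ℕ} (hr : 3 ≤ r) {s : Set Plane} (hs : UniqueDiffOn ℝ s)
    {h : Plane → ℝ} (hh : h ∈ unitBallC r s) :
    HasJet s h (fderivWithin ℝ h s) (fderivWithin ℝ (fderivWithin ℝ h s) s)
      (fderivWithin ℝ (fderivWithin ℝ (fderivWithin ℝ h s) s) s) := by
  obtain ⟨hc, hb⟩ := hh
  have hc3 : ContDiffOn ℝ 3 h s := hc.of_le (by exact_mod_cast hr)
  have c2 : ContDiffOn ℝ 2 (fderivWithin ℝ h s) s := hc3.fderivWithin hs (by norm_num)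
  have c1 : ContDiffOn ℝ 1 (fderivWithin ℝ (fderivWithin ℝ h s) s) s :=
    c2.fderivWithin hs (by norm_num)
  have hbd : ∀ m ≤ r, ∀ x ∈ s, ‖iteratedFDerivWithin ℝ m h s x‖ ≤ 2 ^ m := fun m hm x hx =>
    norm_le_two_pow_of_single _ fun i => hb m hm i x hx
  refine ⟨fun x hx => (hc3.differentiableOn (by norm_num) x hx).hasFDerivWithinAt,
    fun x hx => (c2.differentiableOn (by norm_num) x hx).hasFDerivWithinAt,
    fun x hx => (c1.differentiableOn (by norm_num) x hx).hasFDerivWithinAt, ?_, ?_, ?_, ?_⟩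
  · intro x hx
    simpa using hb 0 (by omega) Fin.elim0 x hx
  · intro x hx
    have := hbd 1 (by omega) x hx
    rw [← norm_iteratedFDerivWithin_fderivWithin hs hx, norm_iteratedFDerivWithin_zero] at this
    simpa using this
  · intro x hx
    have := hbd 2 (by omega) x hx
    rw [← norm_iteratedFDerivWithin_fderivWithin hs hx, ← norm_iteratedFDerivWithin_fderivWithin hs hx,
      norm_iteratedFDerivWithin_zero] at this
    norm_num at this; exact this
  · intro x hx
    have := hbd 3 (by omega) x hx
    rw [← norm_iteratedFDerivWithin_fderivWithin hs hx, ← norm_iteratedFDerivWithin_fderivWithin hs hx,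
      ← norm_iteratedFDerivWithin_fderivWithin hs hx, norm_iteratedFDerivWithin_zero] at this
    norm_num at this; exact this

theorem convex_actionBall (R : ℝ) : Convex ℝ (actionBall R) := convex_closedBall 0 R

theorem uniqueDiffOn_actionBall {R : ℝ} (hR : 0 < R) : UniqueDiffOn ℝ (actionBall R) :=
  uniqueDiffOn_convex (convex_actionBall R)
    ⟨0, mem_interior.2 ⟨Metric.ball 0 R, Metric.ball_subset_closedBall, Metric.isOpen_ball, by simpa⟩⟩

theorem mem_actionBall_iff {R : ℝ} (hR : 0 ≤ R) {I : Plane} :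
    I ∈ actionBall R ↔ ∀ i, |I i| ≤ R := by
  rw [actionBall, mem_closedBall_zero_iff, pi_norm_le_iff_of_nonneg hR]; rfl

theorem norm_taylor_le {E F : Type*} [NormedAddCommGroup E] [NormedSpace ℝ E] [NormedAddCommGroup F]
    [NormedSpace ℝ F] {s : Set E} (hs : Convex ℝ s) {g : E → F} {g' : E → E →L[ℝ] F} {C : ℝ}
    (hg : ∀ x ∈ s, HasFDerivWithinAt g (g' x) s x)
    (hC : ∀ x ∈ s, ∀ y ∈ s, ‖g' x - g' y‖ ≤ C * ‖x - y‖) (hC0 : 0 ≤ C) {x y : E} (hx : x ∈ s)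
    (hy : y ∈ s) : ‖g y - g x - g' x (y - x)‖ ≤ C * ‖y - x‖ ^ 2 := by
  have hseg : segment ℝ x y ⊆ s := hs.segment_subset hx hy
  have h := (convex_segment x y).norm_image_sub_le_of_norm_hasFDerivWithin_le'
    (f := g) (f' := g') (φ := g' x) (C := C * ‖y - x‖)
    (fun z hz => (hg z (hseg hz)).mono hseg) ?_ (left_mem_segment ℝ x y) (right_mem_segment ℝ x y)
  · rw [sq, ← mul_assoc]; exact h
  · intro z hz
    refine (hC z (hseg hz) x hx).trans (mul_le_mul_of_nonneg_left ?_ hC0)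
    obtain ⟨t, ht, rfl⟩ := (segment_eq_image' ℝ x y) ▸ hz
    simp only [add_sub_cancel_left, norm_smul, Real.norm_eq_abs, abs_of_nonneg ht.1]
    exact mul_le_of_le_one_left (norm_nonneg _) ht.2

theorem lipschitz_of_deriv_bound {E F : Type*} [NormedAddCommGroup E] [NormedSpace ℝ E]
    [NormedAddCommGroup F]
    [NormedSpace ℝ F] {s : Set E} (hs : Convex ℝ s) {g : E → F} {g' : E → E →L[ℝ] F} {C : ℝ}
    (hg : ∀ x ∈ s, HasFDerivWithinAt g (g' x) s x) (hC : ∀ x ∈ s, ‖g' x‖ ≤ C) :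
    ∀ x ∈ s, ∀ y ∈ s, ‖g x - g y‖ ≤ C * ‖x - y‖ := fun _ hx _ hy =>
  hs.norm_image_sub_le_of_norm_hasFDerivWithin_le hg hC hy hx

/-- The first zero of a function that is positive at the start. -/
theorem exists_first_zero {m : ℝ → ℝ} {T : ℝ} (hm : ContinuousOn m (Icc 0 T)) (h0 : 0 < m 0)
    (hex : ∃ t ∈ Icc 0 T, m t ≤ 0) : ∃ t ∈ Icc 0 T, m t = 0 ∧ ∀ s ∈ Icc 0 t, 0 ≤ m s := by
  have hcl : IsCompact (Icc 0 T ∩ m ⁻¹' Iic 0) :=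
    isCompact_Icc.of_isClosed_subset (hm.preimage_isClosed_of_isClosed isClosed_Icc isClosed_Iic)
      inter_subset_left
  obtain ⟨t, ⟨ht, hmt⟩, hleast⟩ := hcl.exists_isLeast (by obtain ⟨t, h1, h2⟩ := hex; exact ⟨t, h1, h2⟩)
  have hpos : ∀ s ∈ Ico 0 t, 0 < m s := by
    intro s hs
    by_contra hc
    exact absurd (hleast ⟨⟨hs.1, hs.2.le.trans ht.2⟩, not_lt.1 hc⟩) (not_le.2 hs.2)
  have ht0 : 0 < t := lt_of_le_of_ne ht.1 (by rintro rfl; exact absurd hmt (not_le.2 h0))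
  have hmt' : 0 ≤ m t := by
    have hc : ContinuousWithinAt m (Ico 0 t) t :=
      (hm t ht).mono (fun s hs => ⟨hs.1, hs.2.le.trans ht.2⟩)
    have hne : (𝓝[Ico 0 t] t).NeBot := by
      rw [← mem_closure_iff_nhdsWithin_neBot, closure_Ico ht0.ne]
      exact ⟨ht.1, le_rfl⟩
    exact ge_of_tendsto hc (eventually_mem_nhdsWithin.mono fun s hs => (hpos s hs).le)
  refine ⟨t, ht, le_antisymm hmt hmt', fun s hs => ?_⟩
  rcases eq_or_lt_of_le hs.2 with rfl | h
  · exact hmt'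
  · exact (hpos s ⟨hs.1, h⟩).le

theorem le_of_deriv_nonneg {g g' : ℝ → ℝ} {t : ℝ} (ht : 0 ≤ t)
    (hg : ∀ s ∈ Icc 0 t, HasDerivWithinAt g (g' s) (Icc 0 t) s) (h : ∀ s ∈ Icc 0 t, 0 ≤ g' s) :
    g 0 ≤ g t := by
  have hmono : MonotoneOn g (Icc 0 t) := by
    refine monotoneOn_of_hasDerivWithinAt_nonneg (convex_Icc 0 t)
      (fun s hs => (hg s hs).continuousWithinAt) (f' := g') ?_ ?_
    · intro s hs
      exact (hg s (interior_subset hs)).mono interior_subset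
    · intro s hs; exact h s (interior_subset hs)
  exact hmono ⟨le_rfl, ht⟩ ⟨ht, le_rfl⟩ ht

theorem abs_le_of_gronwall {g g' : ℝ → ℝ} {t C δ η : ℝ} (hC : 0 < C)
    (hg : ∀ s ∈ Icc 0 t, HasDerivWithinAt g (g' s) (Icc 0 t) s) (h0 : |g 0| ≤ δ)
    (h : ∀ s ∈ Icc 0 t, |g' s| ≤ C * |g s| + η) :
    ∀ s ∈ Icc 0 t, |g s| ≤ δ * Real.exp (C * s) + η / C * (Real.exp (C * s) - 1) := by
  intro s hs
  have := norm_le_gronwallBound_of_norm_deriv_right_le (f := g) (f' := g') (δ := δ) (K := C) (ε := η)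
    (a := 0) (b := t) (fun s hs => (hg s hs).continuousWithinAt)
    (fun x hx => (hg x ⟨hx.1, hx.2.le⟩).mono_of_mem_nhdsWithin
      (mem_of_superset (Icc_mem_nhdsGE hx.2) (Icc_subset_Icc_left hx.1))) h0
    (fun x hx => h x ⟨hx.1, hx.2.le⟩) s hs
  rwa [gronwallBound_of_K_ne_0 hC.ne', sub_zero] at this

theorem hasFDerivAt_weighted_integral {P : Plane → ℝ} {P' : Plane → Plane →L[ℝ] ℝ} {C : ℝ}
    (hP : ∀ x, HasFDerivAt P (P' x) x) (hc : Continuous P') (hb : ∀ x, ‖P' x‖ ≤ C) (v : Plane)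
    {φ : ℝ → ℝ} (hφ : Continuous φ) (θ : Plane) :
    HasFDerivAt (fun x => ∫ s in (0 : ℝ)..1, φ s * P (x + s • v))
      (∫ s in (0 : ℝ)..1, φ s • P' (θ + s • v)) θ := by
  have hPc : Continuous P := continuous_iff_continuousAt.2 fun x => (hP x).continuousAt
  have hline : ∀ x : Plane, Continuous fun s : ℝ => x + s • v := fun x => by fun_prop
  have hcont : ∀ x, Continuous fun s : ℝ => φ s * P (x + s • v) := fun x =>
    hφ.mul (hPc.comp (hline x))
  refine intervalIntegral.hasFDerivAt_integral_of_dominated_of_fderiv_le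
    (F' := fun x s => φ s • P' (x + s • v)) (bound := fun s => |φ s| * C) (s := univ) univ_mem
    (Eventually.of_forall fun x => (hcont x).aestronglyMeasurable)
    ((hcont θ).intervalIntegrable _ _)
    (hφ.smul (hc.comp (hline θ))).aestronglyMeasurable ?_
    ((hφ.abs.mul continuous_const).intervalIntegrable _ _) ?_
  · refine Eventually.of_forall fun s _ x _ => ?_
    rw [norm_smul, Real.norm_eq_abs]
    exact mul_le_mul_of_nonneg_left (hb _) (abs_nonneg _)
  · refine Eventually.of_forall fun s _ x _ => ?_
    have h1 : HasFDerivAt (fun y : Plane => P (y + s • v)) (P' (x + s • v)) x := by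
      simpa [Function.comp_def] using!
        (hP (x + s • v)).comp x ((hasFDerivAt_id x).add_const (s • v))
    simpa using h1.const_mul (φ s)

/-- A function whose derivative along `k` is, for periodic `P`, the deviation of `P` from its
average along `k`. -/
noncomputable def corrector (v : Plane) (P : Plane → ℝ) (θ : Plane) : ℝ :=
  ∫ s in (0 : ℝ)..1, s * P (θ + s • v)

noncomputable def correctorDeriv (v : Plane) (P' : Plane → Plane →L[ℝ] ℝ) (θ : Plane) :
    Plane →L[ℝ] ℝ :=
  ∫ s in (0 : ℝ)..1, s • P' (θ + s • v)

theorem abs_corrector_le {P : Plane → ℝ} {C : ℝ} (hb : ∀ x, |P x| ≤ C) (v θ : Plane) :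
    |corrector v P θ| ≤ C := by
  have := intervalIntegral.norm_integral_le_of_norm_le_const (a := 0) (b := 1) (C := C)
    (f := fun s : ℝ => s * P (θ + s • v)) ?_
  · simpa [corrector] using this
  · intro s hs
    rw [uIoc_of_le zero_le_one] at hs
    rw [norm_mul, Real.norm_eq_abs, Real.norm_eq_abs, abs_of_pos hs.1]
    exact (mul_le_of_le_one_left (abs_nonneg _) hs.2).trans (hb _)

theorem norm_correctorDeriv_le {P' : Plane → Plane →L[ℝ] ℝ} {C : ℝ} (hb : ∀ x, ‖P' x‖ ≤ C)
    (v θ : Plane) : ‖correctorDeriv v P' θ‖ ≤ C := by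
  have := intervalIntegral.norm_integral_le_of_norm_le_const (a := 0) (b := 1) (C := C)
    (f := fun s : ℝ => s • P' (θ + s • v)) ?_
  · simpa [correctorDeriv] using this
  · intro s hs
    rw [uIoc_of_le zero_le_one] at hs
    rw [norm_smul, Real.norm_eq_abs, abs_of_pos hs.1]
    exact (mul_le_of_le_one_left (norm_nonneg _) hs.2).trans (hb _)

theorem hasFDerivAt_corrector {P : Plane → ℝ} {P' : Plane → Plane →L[ℝ] ℝ} {C : ℝ}
    (hP : ∀ x, HasFDerivAt P (P' x) x) (hc : Continuous P') (hb : ∀ x, ‖P' x‖ ≤ C) (v θ : Plane) :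
    HasFDerivAt (corrector v P) (correctorDeriv v P' θ) θ :=
  hasFDerivAt_weighted_integral hP hc hb v continuous_id θ

theorem correctorDeriv_apply_self {k : Fin 2 → ℤ} {P : Plane → ℝ} {P' : Plane → Plane →L[ℝ] ℝ}
    (hP : ∀ x, HasFDerivAt P (P' x) x) (hc : Continuous P')
    (hper : ∀ (m : Fin 2 → ℤ) θ, P (θ + toPlane m) = P θ) (θ : Plane) :
    correctorDeriv (toPlane k) P' θ (toPlane k) = P θ - kAverage k P θ := by
  have hline : Continuous fun s : ℝ => θ + s • toPlane k := by fun_prop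
  have hPd : ∀ s : ℝ, HasDerivAt (fun s : ℝ => P (θ + s • toPlane k))
      (P' (θ + s • toPlane k) (toPlane k)) s := fun s => by
    have h1 : HasDerivAt (fun s : ℝ => θ + s • toPlane k) (toPlane k) s := by
      simpa using ((hasDerivAt_id s).smul_const (toPlane k)).const_add θ
    exact (hP _).comp_hasDerivAt s h1
  have hc' : Continuous fun s : ℝ => P' (θ + s • toPlane k) (toPlane k) :=
    (hc.comp hline).clm_apply continuous_const
  have hint : IntervalIntegrable (fun s : ℝ => s • P' (θ + s • toPlane k)) volume 0 1 :=
    (continuous_id.smul (hc.comp hline)).intervalIntegrable _ _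
  rw [correctorDeriv, ContinuousLinearMap.intervalIntegral_apply hint]
  have hparts := intervalIntegral.integral_mul_deriv_eq_deriv_mul (a := 0) (b := 1)
    (u := fun s : ℝ => s) (u' := fun _ => 1) (v := fun s : ℝ => P (θ + s • toPlane k))
    (v' := fun s : ℝ => P' (θ + s • toPlane k) (toPlane k))
    (fun s _ => hasDerivAt_id s) (fun s _ => hPd s) (continuous_const.intervalIntegrable _ _)
    (hc'.intervalIntegrable _ _)
  simp only [smul_apply, smul_eq_mul]
  rw [hparts]
  simp [hper, kAverage]

theorem hasFDerivAt_kAverage {k : Fin 2 → ℤ} {P : Plane → ℝ} {P' : Plane → Plane →L[ℝ] ℝ} {C : ℝ}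
    (hP : ∀ x, HasFDerivAt P (P' x) x) (hc : Continuous P') (hb : ∀ x, ‖P' x‖ ≤ C) (θ : Plane) :
    HasFDerivAt (kAverage k P) (∫ s in (0 : ℝ)..1, P' (θ + s • toPlane k)) θ := by
  simpa [kAverage, Function.comp_def] using! hasFDerivAt_weighted_integral hP hc hb (toPlane k)
    (continuous_const (y := (1 : ℝ))) θ

theorem fderiv_kAverage_apply {k : Fin 2 → ℤ} {P : Plane → ℝ} {P' : Plane → Plane →L[ℝ] ℝ} {C : ℝ}
    (hP : ∀ x, HasFDerivAt P (P' x) x) (hc : Continuous P') (hb : ∀ x, ‖P' x‖ ≤ C) (θ v : Plane) :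
    fderiv ℝ (kAverage k P) θ v = kAverage k (fun x => P' x v) θ := by
  have hline : Continuous fun s : ℝ => θ + s • toPlane k := by fun_prop
  have hint : IntervalIntegrable (fun s : ℝ => P' (θ + s • toPlane k)) volume 0 1 :=
    (hc.comp hline).intervalIntegrable _ _
  rw [(hasFDerivAt_kAverage hP hc hb θ).fderiv, ContinuousLinearMap.intervalIntegral_apply hint]
  rfl

theorem kAverage_add_smul {k : Fin 2 → ℤ} {P : Plane → ℝ}
    (hper : ∀ (m : Fin 2 → ℤ) θ, P (θ + toPlane m) = P θ) (θ : Plane) (r : ℝ) :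
    kAverage k P (θ + r • toPlane k) = kAverage k P θ := by
  have hp : Function.Periodic (fun t : ℝ => P (θ + t • toPlane k)) 1 := fun t => by
    simp only [add_smul, one_smul, ← add_assoc, hper]
  have h1 : ∀ t : ℝ, P (θ + r • toPlane k + t • toPlane k)
      = (fun t : ℝ => P (θ + t • toPlane k)) (t + r) := fun t => by
    simp only [add_smul]; congr 1; abel
  simp only [kAverage, h1]
  rw [intervalIntegral.integral_comp_add_right (fun t : ℝ => P (θ + t • toPlane k)) r]
  have := hp.intervalIntegral_add_eq r 0
  simpa [add_comm] using this

theorem kAverage_add_int {k : Fin 2 → ℤ} {P : Plane → ℝ}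
    (hper : ∀ (m : Fin 2 → ℤ) θ, P (θ + toPlane m) = P θ) (θ : Plane) (m : Fin 2 → ℤ) :
    kAverage k P (θ + toPlane m) = kAverage k P θ := by
  have h1 : ∀ t : ℝ, θ + toPlane m + t • toPlane k = θ + t • toPlane k + toPlane m := fun t => by
    abel
  simp only [kAverage, h1, hper]

theorem abs_kAverage_sub_le {k : Fin 2 → ℤ} {P : Plane → ℝ} (hPc : Continuous P) {C : ℝ}
    (hlip : ∀ x y, |P x - P y| ≤ C * ‖x - y‖) (x y : Plane) :
    |kAverage k P x - kAverage k P y| ≤ C * ‖x - y‖ := by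
  have hline : ∀ x : Plane, Continuous fun s : ℝ => P (x + s • toPlane k) := fun x =>
    hPc.comp (by fun_prop)
  rw [kAverage, kAverage, ← intervalIntegral.integral_sub ((hline x).intervalIntegrable _ _)
    ((hline y).intervalIntegrable _ _)]
  have := intervalIntegral.norm_integral_le_of_norm_le_const (a := 0) (b := 1) (C := C * ‖x - y‖)
    (f := fun s : ℝ => P (x + s • toPlane k) - P (y + s • toPlane k)) ?_
  · simpa using this
  · intro s _
    simpa using hlip (x + s • toPlane k) (y + s • toPlane k)

theorem exists_eq_kAverage {k : Fin 2 → ℤ} {P : Plane → ℝ} (hPc : Continuous P) (θ : Plane) :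
    ∃ s : ℝ, P (θ + s • toPlane k) = kAverage k P θ := by
  have hline : Continuous fun s : ℝ => P (θ + s • toPlane k) := hPc.comp (by fun_prop)
  obtain ⟨c, _, hc⟩ := exists_eq_const_mul_intervalIntegral_of_nonneg (a := 0) (b := 1)
    (μ := volume) (f := fun s : ℝ => P (θ + s • toPlane k)) (g := fun _ => (1 : ℝ))
    hline.continuousOn (continuous_const.intervalIntegrable _ _) (fun _ _ => zero_le_one)
  exact ⟨c, by simpa [kAverage] using hc.symm⟩

theorem exists_global_solution {E : Type*} [NormedAddCommGroup E] [NormedSpace ℝ E] [CompleteSpace E]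
    {v : E → E} {K L : NNReal} (hK : LipschitzWith K v) (hL : ∀ x, ‖v x‖ ≤ L) (x₀ : E) {T : ℝ}
    (hT : 0 ≤ T) :
    ∃ γ : ℝ → E, γ 0 = x₀ ∧ ∀ t ∈ Icc 0 T, HasDerivWithinAt γ (v (γ t)) (Icc 0 T) t := by
  have hpl : IsPicardLindelof (fun _ : ℝ => v) (tmin := 0) (tmax := T) ⟨0, le_rfl, hT⟩ x₀
      (L * T.toNNReal) 0 L K :=
    { lipschitzOnWith := fun _ _ => hK.lipschitzOnWith
      continuousOn := fun _ _ => continuousOn_const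
      norm_le := fun _ _ x _ => hL x
      mul_max_le := by simp [hT] }
  exact hpl.exists_eq_forall_mem_Icc_hasDerivWithinAt₀

/-- The vector with the coordinates of a linear form. -/
def gradVec (L : Plane →L[ℝ] ℝ) : Plane := fun i => L (Pi.single i 1)

theorem norm_single_one (i : Fin 2) : ‖(Pi.single i 1 : Plane)‖ = 1 := by
  rw [Pi.norm_single]; simp

theorem norm_gradVec_le (L : Plane →L[ℝ] ℝ) : ‖gradVec L‖ ≤ ‖L‖ := by
  refine (pi_norm_le_iff_of_nonneg (norm_nonneg _)).2 fun i => ?_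
  simpa [norm_single_one, gradVec] using L.le_opNorm (Pi.single i 1 : Plane)

theorem gradVec_sub (L L' : Plane →L[ℝ] ℝ) : gradVec (L - L') = gradVec L - gradVec L' := rfl

theorem clm_apply_eq (L : Plane →L[ℝ] ℝ) (z : Plane) :
    L z = z 0 * gradVec L 0 + z 1 * gradVec L 1 := by
  have : z = z 0 • (Pi.single 0 1 : Plane) + z 1 • (Pi.single 1 1 : Plane) := by
    ext i; fin_cases i <;> simp
  conv_lhs => rw [this]
  simp [gradVec]

/-- The nearest point of the square `B_R`. -/
noncomputable def clamp (R : ℝ) (I : Plane) : Plane := fun i => max (-R) (min R (I i))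

theorem clamp_mem {R : ℝ} (hR : 0 ≤ R) (I : Plane) : clamp R I ∈ actionBall R := by
  rw [mem_actionBall_iff hR]
  intro i
  rw [abs_le]
  exact ⟨le_max_left _ _, max_le (by linarith) (min_le_left _ _)⟩

theorem clamp_eq {R : ℝ} (hR : 0 ≤ R) {I : Plane} (hI : I ∈ actionBall R) : clamp R I = I := by
  rw [mem_actionBall_iff hR] at hI
  ext i
  have := abs_le.1 (hI i)
  simp [clamp, this.1, this.2]

theorem norm_clamp_sub_le (R : ℝ) (I J : Plane) : ‖clamp R I - clamp R J‖ ≤ ‖I - J‖ := by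
  refine (pi_norm_le_iff_of_nonneg (norm_nonneg _)).2 fun i => ?_
  refine le_trans ?_ (norm_le_pi_norm (I - J) i)
  simp only [clamp, Pi.sub_apply, Real.norm_eq_abs]
  refine (abs_max_sub_max_le_max _ _ _ _).trans ?_
  rw [sub_self, abs_zero, max_eq_right (abs_nonneg _)]
  refine (abs_min_sub_min_le_max _ _ _ _).trans ?_
  rw [sub_self, abs_zero, max_eq_right (abs_nonneg _)]

theorem exists_trajectory {R : ℝ} (hR : 0 < R) {h f H1 H2 H3 F1 F2 F3}
    (hh : HasJet (actionBall R) h H1 H2 H3) (hf : HasJet univ f F1 F2 F3) (ε : ℝ) {T : ℝ}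
    (hT : 0 ≤ T) (θ₀ I₀ : Plane) :
    ∃ θ I : ℝ → Plane, θ 0 = θ₀ ∧ I 0 = I₀ ∧
      (∀ t ∈ Icc 0 T, HasDerivWithinAt θ (gradVec (H1 (clamp R (I t)))) (Icc 0 T) t) ∧
      ∀ t ∈ Icc 0 T, HasDerivWithinAt I (-(ε • gradVec (F1 (θ t)))) (Icc 0 T) t := by
  have lipH := lipschitz_of_deriv_bound (convex_actionBall R) hh.d2 hh.b2
  have lipF := lipschitz_of_deriv_bound convex_univ hf.d2 hf.b2
  set v : Plane × Plane → Plane × Plane := fun x =>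
    (gradVec (H1 (clamp R x.2)), -(ε • gradVec (F1 x.1))) with hv
  have hK : LipschitzWith (4 + ‖ε‖₊ * 4) v := by
    refine LipschitzWith.of_dist_le_mul fun x y => ?_
    rw [dist_eq_norm, dist_eq_norm]
    have e1 : ‖x.1 - y.1‖ ≤ ‖x - y‖ := norm_fst_le (x - y)
    have e2 : ‖x.2 - y.2‖ ≤ ‖x - y‖ := norm_snd_le (x - y)
    have a1 : ‖gradVec (H1 (clamp R x.2)) - gradVec (H1 (clamp R y.2))‖ ≤ 4 * ‖x - y‖ := by
      rw [← gradVec_sub]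
      refine (norm_gradVec_le _).trans ((lipH _ (clamp_mem hR.le _) _ (clamp_mem hR.le _)).trans ?_)
      linarith [norm_clamp_sub_le R x.2 y.2]
    have a2 : ‖-(ε • gradVec (F1 x.1)) - -(ε • gradVec (F1 y.1))‖ ≤ ‖ε‖ * (4 * ‖x - y‖) := by
      rw [neg_sub_neg, ← smul_sub, norm_smul, ← gradVec_sub, norm_sub_rev x y]
      refine mul_le_mul_of_nonneg_left ((norm_gradVec_le _).trans ?_) (norm_nonneg _)
      refine (lipF _ (mem_univ _) _ (mem_univ _)).trans ?_
      rw [norm_sub_rev y.1, norm_sub_rev y]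
      linarith
    have hn : 0 ≤ ‖ε‖ * (4 * ‖x - y‖) := by positivity
    have hn' : 0 ≤ 4 * ‖x - y‖ := by positivity
    have : ((4 + ‖ε‖₊ * 4 : NNReal) : ℝ) * ‖x - y‖ = 4 * ‖x - y‖ + ‖ε‖ * (4 * ‖x - y‖) := by
      push_cast; ring
    rw [this]
    exact max_le (a1.trans (by linarith)) (a2.trans (by linarith))
  have hL : ∀ x, ‖v x‖ ≤ ((2 + ‖ε‖₊ * 2 : NNReal) : ℝ) := by
    intro x
    push_cast
    have a1 : ‖gradVec (H1 (clamp R x.2))‖ ≤ 2 :=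
      (norm_gradVec_le _).trans (hh.b1 _ (clamp_mem hR.le _))
    have a2 : ‖-(ε • gradVec (F1 x.1))‖ ≤ ‖ε‖ * 2 := by
      rw [norm_neg, norm_smul]
      exact mul_le_mul_of_nonneg_left ((norm_gradVec_le _).trans (hf.b1 _ (mem_univ _)))
        (norm_nonneg _)
    have hn : 0 ≤ ‖ε‖ * 2 := by positivity
    exact max_le (a1.trans (by linarith)) (a2.trans (by linarith))
  obtain ⟨γ, h0, hγ⟩ := exists_global_solution hK hL (θ₀, I₀) hT
  refine ⟨fun t => (γ t).1, fun t => (γ t).2, by simp [h0], by simp [h0], fun t ht => ?_, fun t ht => ?_⟩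
  · exact (ContinuousLinearMap.fst ℝ Plane Plane).hasFDerivAt.comp_hasDerivWithinAt t (hγ t ht)
  · exact (ContinuousLinearMap.snd ℝ Plane Plane).hasFDerivAt.comp_hasDerivWithinAt t (hγ t ht)

/-- The Euclidean scalar product. -/
def dot (v z : Plane) : ℝ := v 0 * z 0 + v 1 * z 1

/-- `u` is `k` turned by a right angle; `N = |k|²`, and `M` bounds everything. -/
structure Frame (k : Fin 2 → ℤ) (u : Plane) (N M : ℝ) : Prop where
  perp : ∃ s : ℝ, s ^ 2 = 1 ∧ u 0 = s * k 1 ∧ u 1 = -(s * k 0)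
  sq : N = (k 0 : ℝ) ^ 2 + (k 1 : ℝ) ^ 2
  one_le : 1 ≤ N
  le : N ≤ M
  norm_u : ‖u‖ ≤ M
  norm_k : ‖toPlane k‖ ≤ M
  eight_le : 8 ≤ M

namespace Frame

variable {k : Fin 2 → ℤ} {u : Plane} {N M : ℝ} (F : Frame k u N M)
include F

theorem dot_self : dot u u = N := by
  obtain ⟨s, hs, h0, h1⟩ := F.perp
  rw [dot, h0, h1, F.sq]; linear_combination ((k 1 : ℝ) ^ 2 + (k 0 : ℝ) ^ 2) * hs

theorem dot_k : dot u (toPlane k) = 0 := by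
  obtain ⟨s, hs, h0, h1⟩ := F.perp
  rw [dot, h0, h1, toPlane, toPlane]; ring

theorem decomp (z : Plane) :
    z = (dot u z / N) • u + (dot (toPlane k) z / N) • toPlane k := by
  have hN : N ≠ 0 := (zero_lt_one.trans_le F.one_le).ne'
  obtain ⟨s, hs, h0, h1⟩ := F.perp
  have hN' : (k 0 : ℝ) ^ 2 + (k 1 : ℝ) ^ 2 = N := F.sq.symm
  ext i
  fin_cases i
  · simp only [dot, toPlane, h0, h1, Pi.add_apply, Pi.smul_apply, smul_eq_mul, Fin.zero_eta]
    field_simp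
    linear_combination (-z 0) * hN' - (z 0 * (k 1 : ℝ) ^ 2 - z 1 * k 0 * k 1) * hs
  · simp only [dot, toPlane, h0, h1, Pi.add_apply, Pi.smul_apply, smul_eq_mul, Fin.mk_one]
    field_simp
    linear_combination (-z 1) * hN' - (z 1 * (k 0 : ℝ) ^ 2 - z 0 * k 0 * k 1) * hs

theorem apply_gradVec (G A : Plane →L[ℝ] ℝ) :
    G (gradVec A) = A u / N * G u + A (toPlane k) / N * G (toPlane k) := by
  conv_lhs => rw [F.decomp (gradVec A)]
  simp [dot, clm_apply_eq A u, clm_apply_eq A (toPlane k)]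

theorem abs_kAverage_sub_le {P : Plane → ℝ} (hPc : Continuous P) {C : ℝ} (hC : 0 ≤ C)
    (hlip : ∀ x y, |P x - P y| ≤ C * ‖x - y‖)
    (hper : ∀ (m : Fin 2 → ℤ) θ, P (θ + toPlane m) = P θ) (x y : Plane) :
    |kAverage k P x - kAverage k P y| ≤ C * M * |dot u x - dot u y| := by
  have hx : x = y + (dot u (x - y) / N) • u + (dot (toPlane k) (x - y) / N) • toPlane k := by
    rw [add_assoc, ← F.decomp (x - y)]; abel
  have hd : dot u (x - y) = dot u x - dot u y := by simp [dot]; ring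
  rw [hx, kAverage_add_smul hper, ← hx]
  refine (FastDrift.abs_kAverage_sub_le hPc hlip _ _).trans ?_
  rw [add_sub_cancel_left, norm_smul, mul_assoc, hd, Real.norm_eq_abs, abs_div,
    abs_of_pos (zero_lt_one.trans_le F.one_le), mul_comm M]
  refine mul_le_mul_of_nonneg_left ?_ hC
  exact mul_le_mul (div_le_self (abs_nonneg _) F.one_le) F.norm_u (norm_nonneg _) (abs_nonneg _)

end Frame

theorem abs_mul_le_mul {a b A B : ℝ} (ha : |a| ≤ A) (hb : |b| ≤ B) : |a * b| ≤ A * B := by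
  rw [abs_mul]
  exact mul_le_mul ha hb (abs_nonneg _) ((abs_nonneg _).trans ha)

theorem const_mul_pow_le {M c : ℝ} (hM : 8 ≤ M) (a j n : ℕ) (hn : a + j = n)
    (hc : c ≤ 8 ^ j) : c * M ^ a ≤ M ^ n := by
  rw [← hn, pow_add, mul_comm (M ^ a)]
  exact mul_le_mul_of_nonneg_right (hc.trans (pow_le_pow_left₀ (by norm_num) hM j)) (by positivity)

theorem abs_apply_le {L : Plane →L[ℝ] ℝ} {v : Plane} {A B : ℝ} (hL : ‖L‖ ≤ A) (hv : ‖v‖ ≤ B) :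
    |L v| ≤ A * B :=
  (L.le_opNorm v).trans (mul_le_mul hL hv (norm_nonneg _) ((norm_nonneg _).trans hL))

theorem abs_apply₂_le {L : Plane →L[ℝ] Plane →L[ℝ] ℝ} {v w : Plane} {A B C : ℝ} (hL : ‖L‖ ≤ A)
    (hv : ‖v‖ ≤ B) (hw : ‖w‖ ≤ C) : |L v w| ≤ A * B * C :=
  abs_apply_le ((L.le_opNorm v).trans (mul_le_mul hL hv (norm_nonneg _) ((norm_nonneg _).trans hL))) hw

theorem abs_apply₃_le {L : Plane →L[ℝ] Plane →L[ℝ] Plane →L[ℝ] ℝ} {v w x : Plane} {A B C D : ℝ}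
    (hL : ‖L‖ ≤ A) (hv : ‖v‖ ≤ B) (hw : ‖w‖ ≤ C) (hx : ‖x‖ ≤ D) : |L v w x| ≤ A * B * C * D :=
  abs_apply₂_le ((L.le_opNorm v).trans (mul_le_mul hL hv (norm_nonneg _) ((norm_nonneg _).trans hL)))
    hw hx

/-- Consequences of the energy relation near the resonant line. -/
theorem near_resonance {k : Fin 2 → ℤ} {u : Plane} {N M R : ℝ} (F : Frame k u N M)
    {h H1 H2 H3} (hh : HasJet (actionBall R) h H1 H2 H3) {I J : Plane} {Y ε e E f : ℝ}
    (hI : I ∈ actionBall R) (hJ : J ∈ actionBall R) (hIJ : I = J + Y • toPlane k) (he : h J = e)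
    (hu : H1 J u = 0) (hk : 2 / M ≤ |H1 J (toPlane k)|) (hε : 0 < ε) (hsmall : 16 * M ^ 5 * ε ≤ 1)
    (hY : |Y| ≤ 8 * M * ε) (hen : h I + ε * f = e + ε * E) (hf : |f| ≤ 1) (hE : |E| ≤ 1) :
    |Y| ≤ 4 * M * ε ∧ 1 / M ≤ |H1 I (toPlane k)| ∧ |H1 I u| ≤ M ^ 5 * ε ∧
      |H1 I u * H1 I (toPlane k) - ε * H2 I (toPlane k) u * (E - f)| ≤ M ^ 11 * ε ^ 2 := by
  have hM := F.eight_le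
  have hM0 : 0 < M := by linarith
  have hJI : J - I = -(Y • toPlane k) := by rw [hIJ]; abel
  have hnorm : ‖J - I‖ ≤ |Y| * M := by
    rw [hJI, norm_neg, norm_smul, Real.norm_eq_abs]
    exact mul_le_mul_of_nonneg_left F.norm_k (abs_nonneg _)
  have hnorm' : ‖J - I‖ ≤ 8 * M ^ 2 * ε :=
    hnorm.trans (by nlinarith [mul_le_mul_of_nonneg_right hY hM0.le])
  have hB := convex_actionBall R
  have l1 := lipschitz_of_deriv_bound hB hh.d2 hh.b2
  have l2 := lipschitz_of_deriv_bound hB hh.d3 hh.b3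
  have hsq : Y ^ 2 ≤ 64 * M ^ 2 * ε ^ 2 := by
    rw [← sq_abs]; nlinarith [abs_nonneg Y, hY, hM0.le, hε.le]
  have p4 : 64 * M ^ 4 * ε ≤ 1 := by
    refine le_trans ?_ hsmall
    have : 4 * M ^ 4 ≤ M ^ 5 := by nlinarith [pow_pos hM0 4]
    nlinarith
  -- the frequency
  have hW : 1 / M ≤ |H1 I (toPlane k)| := by
    have d : |H1 J (toPlane k) - H1 I (toPlane k)| ≤ 4 * (8 * M ^ 2 * ε) * M := by
      have := abs_apply_le (L := H1 J - H1 I) (v := toPlane k)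
        ((l1 J hJ I hI).trans (mul_le_mul_of_nonneg_left hnorm' (by norm_num))) F.norm_k
      simpa using this
    have d2 : 4 * (8 * M ^ 2 * ε) * M ≤ 1 / M := by
      rw [le_div_iff₀ hM0]; nlinarith [pow_pos hM0 4]
    have d3 : 2 / M = 1 / M + 1 / M := by ring
    have d4 := abs_sub_abs_le_abs_sub (H1 J (toPlane k)) (H1 I (toPlane k))
    linarith
  -- the energy relation
  have t1 : |Y * H1 I (toPlane k) - ε * (E - f)| ≤ 4 * M ^ 2 * Y ^ 2 := by
    have := norm_taylor_le hB hh.d1 l1 (by norm_num) hI hJ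
    rw [hJI, map_neg, map_smul, smul_eq_mul, sub_neg_eq_add, norm_neg, norm_smul, mul_pow,
      Real.norm_eq_abs, Real.norm_eq_abs, sq_abs] at this
    have e1 : h J - h I + Y * H1 I (toPlane k) = Y * H1 I (toPlane k) - ε * (E - f) := by
      rw [he]; linarith
    rw [e1] at this
    have := F.norm_k
    have hk2 : ‖toPlane k‖ ^ 2 ≤ M ^ 2 := pow_le_pow_left₀ (norm_nonneg _) this 2
    nlinarith [sq_nonneg Y]
  have hnorm'' : ‖I - J‖ ≤ 8 * M ^ 2 * ε := by rwa [norm_sub_rev]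
  have hψ : |H1 I u| ≤ M ^ 5 * ε := by
    have := abs_apply_le (L := H1 I - H1 J) (v := u)
        ((l1 I hI J hJ).trans (mul_le_mul_of_nonneg_left hnorm'' (by norm_num))) F.norm_u
    rw [sub_apply, hu, sub_zero] at this
    refine this.trans ?_
    calc 4 * (8 * M ^ 2 * ε) * M = 32 * M ^ 3 * ε := by ring
      _ ≤ _ := mul_le_mul_of_nonneg_right (const_mul_pow_le hM 3 2 5 rfl (by norm_num)) hε.le
  refine ⟨?_, hW, hψ, ?_⟩
  · have hfE : |E - f| ≤ 2 := (abs_sub _ _).trans (by linarith)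
    have a1 : |Y| * |H1 I (toPlane k)| ≤ 2 * ε + 4 * M ^ 2 * Y ^ 2 := by
      rw [← abs_mul]
      have := abs_sub_abs_le_abs_sub (Y * H1 I (toPlane k)) (ε * (E - f))
      rw [abs_mul ε, abs_of_pos hε] at this
      nlinarith
    have a2 : |Y| * (1 / M) ≤ |Y| * |H1 I (toPlane k)| :=
      mul_le_mul_of_nonneg_left hW (abs_nonneg _)
    have a3 : Y ^ 2 ≤ |Y| * (8 * M * ε) := by
      rw [← sq_abs, sq]; exact mul_le_mul_of_nonneg_left hY (abs_nonneg _)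
    have a4 : |Y| * (1 / M) ≤ 2 * ε + |Y| * (32 * M ^ 3 * ε) := by nlinarith [sq_nonneg M]
    have a5 : 32 * M ^ 3 * ε ≤ (1 / M) / 2 := by
      rw [div_div, le_div_iff₀ (by positivity)]; nlinarith
    have a6 : |Y| * (1 / M) / 2 ≤ 2 * ε := by
      nlinarith [mul_le_mul_of_nonneg_left a5 (abs_nonneg Y)]
    have : |Y| = |Y| * (1 / M) / 2 * (2 * M) := by field_simp
    rw [this]; nlinarith
  · -- the slope of the energy level
    have t2 : |H1 I u - Y * H2 I (toPlane k) u| ≤ 8 * M ^ 3 * Y ^ 2 := by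
      have := norm_taylor_le hB hh.d2 l2 (by norm_num) hI hJ
      have := abs_apply_le this F.norm_u
      rw [hJI, map_neg, map_smul, norm_neg, norm_smul, mul_pow, Real.norm_eq_abs, sq_abs] at this
      simp only [sub_apply, neg_apply, smul_apply, hu, smul_eq_mul] at this
      rw [abs_sub_comm] at this
      have hk2 : ‖toPlane k‖ ^ 2 ≤ M ^ 2 := pow_le_pow_left₀ (norm_nonneg _) F.norm_k 2
      have e1 : -(Y * H2 I (toPlane k) u) - (0 - H1 I u) = H1 I u - Y * H2 I (toPlane k) u := by ring
      rw [e1] at this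
      refine this.trans ?_
      have : Y ^ 2 * ‖toPlane k‖ ^ 2 ≤ Y ^ 2 * M ^ 2 := mul_le_mul_of_nonneg_left hk2 (sq_nonneg _)
      calc _ ≤ 8 * (Y ^ 2 * M ^ 2) * M := by gcongr
        _ = _ := by ring
    have bW : |H1 I (toPlane k)| ≤ M ^ 2 :=
      (abs_apply_le (hh.b1 I hI) F.norm_k).trans (by nlinarith)
    have bK : |H2 I (toPlane k) u| ≤ M ^ 3 :=
      (abs_apply₂_le (hh.b2 I hI) F.norm_k F.norm_u).trans
        ((by ring : 4 * M * M = 4 * M ^ 2).trans_le (const_mul_pow_le hM 2 1 3 rfl (by norm_num)))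
    have e1 : H1 I u * H1 I (toPlane k) - ε * H2 I (toPlane k) u * (E - f)
        = (H1 I u - Y * H2 I (toPlane k) u) * H1 I (toPlane k)
          + (Y * H1 I (toPlane k) - ε * (E - f)) * H2 I (toPlane k) u := by ring
    rw [e1]
    refine (abs_add_le _ _).trans ((add_le_add (abs_mul_le_mul t2 bW) (abs_mul_le_mul t1 bK)).trans ?_)
    have : 8 * M ^ 3 * Y ^ 2 * M ^ 2 + 4 * M ^ 2 * Y ^ 2 * M ^ 3 = 12 * M ^ 5 * Y ^ 2 := by ring
    rw [this]
    have := const_mul_pow_le (c := 12 * 64) hM 7 4 11 rfl (by norm_num)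
    calc _ ≤ 12 * M ^ 5 * (64 * M ^ 2 * ε ^ 2) := by gcongr
      _ = 12 * 64 * M ^ 7 * ε ^ 2 := by ring
      _ ≤ _ := by gcongr

/-- An orbit on `[0, t]` that stays near the resonant line, with the estimates available there. -/
structure NearOrbit (R : ℝ) (k : Fin 2 → ℤ) (u : Plane) (M ε E t : ℝ) (f : Plane → ℝ)
    (H1 : Plane → Plane →L[ℝ] ℝ) (H2 : Plane → Plane →L[ℝ] Plane →L[ℝ] ℝ)
    (F1 : Plane → Plane →L[ℝ] ℝ) (θ I : ℝ → Plane) : Prop where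
  angle : ∀ s ∈ Icc 0 t, HasDerivWithinAt θ (gradVec (H1 (I s))) (Icc 0 t) s
  action : ∀ s ∈ Icc 0 t, HasDerivWithinAt I (-(ε • gradVec (F1 (θ s)))) (Icc 0 t) s
  mem : ∀ s ∈ Icc 0 t, I s ∈ actionBall R
  freq : ∀ s ∈ Icc 0 t, 1 / M ≤ |H1 (I s) (toPlane k)|
  slow : ∀ s ∈ Icc 0 t, |H1 (I s) u| ≤ M ^ 5 * ε
  slope : ∀ s ∈ Icc 0 t, |H1 (I s) u * H1 (I s) (toPlane k)
    - ε * H2 (I s) (toPlane k) u * (E - f (θ s))| ≤ M ^ 11 * ε ^ 2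

theorem energy_eq {R : ℝ} {h f H1 H2 H3 F1 F2 F3} (hh : HasJet (actionBall R) h H1 H2 H3)
    (hf : HasJet univ f F1 F2 F3) {ε t : ℝ} {θ I : ℝ → Plane}
    (hθ : ∀ s ∈ Icc 0 t, HasDerivWithinAt θ (gradVec (H1 (I s))) (Icc 0 t) s)
    (hI : ∀ s ∈ Icc 0 t, HasDerivWithinAt I (-(ε • gradVec (F1 (θ s)))) (Icc 0 t) s)
    (hm : ∀ s ∈ Icc 0 t, I s ∈ actionBall R) :
    ∀ s ∈ Icc 0 t, h (I s) + ε * f (θ s) = h (I 0) + ε * f (θ 0) := by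
  have hd : ∀ s ∈ Icc 0 t, HasDerivWithinAt (fun s => h (I s) + ε * f (θ s)) 0 (Icc 0 t) s := by
    intro s hs
    have h1 := (hh.d1 (I s) (hm s hs)).comp_hasDerivWithinAt s (hI s hs) hm
    have h2 := (hf.d1 (θ s) (mem_univ _)).comp_hasDerivWithinAt s (hθ s hs) (mapsTo_univ _ _)
    refine (h1.add (h2.const_mul ε)).congr_deriv ?_
    rw [map_neg, map_smul, clm_apply_eq (H1 (I s)), clm_apply_eq (F1 (θ s)), smul_eq_mul]
    ring
  intro s hs
  refine constant_of_has_deriv_right_zero (fun s hs => (hd s hs).continuousWithinAt)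
    (fun x hx => (hd x ⟨hx.1, hx.2.le⟩).mono_of_mem_nhdsWithin
      (mem_of_superset (Icc_mem_nhdsGE hx.2) (Icc_subset_Icc_left hx.1))) s hs

theorem jet_continuous {f F1 F2 F3} (hf : HasJet univ f F1 F2 F3) :
    Continuous f ∧ Continuous F1 ∧ Continuous F2 := by
  refine ⟨continuous_iff_continuousAt.2 fun x => ?_, continuous_iff_continuousAt.2 fun x => ?_,
    continuous_iff_continuousAt.2 fun x => ?_⟩
  · exact (hf.d1 x (mem_univ x)).continuousWithinAt.continuousAt univ_mem
  · exact (hf.d2 x (mem_univ x)).continuousWithinAt.continuousAt univ_mem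
  · exact (hf.d3 x (mem_univ x)).continuousWithinAt.continuousAt univ_mem

theorem hasDerivWithinAt_dot {γ : ℝ → Plane} {γ' v : Plane} {s : Set ℝ} {x : ℝ}
    (hγ : HasDerivWithinAt γ γ' s x) :
    HasDerivWithinAt (fun t => dot v (γ t)) (dot v γ') s x := by
  have := hasDerivWithinAt_pi.1 hγ
  exact ((this 0).const_mul (v 0)).add ((this 1).const_mul (v 1))

theorem dot_gradVec (A : Plane →L[ℝ] ℝ) (v : Plane) : dot v (gradVec A) = A v :=
  (clm_apply_eq A v).symm

theorem dot_neg_smul (v z : Plane) (c : ℝ) : dot v (-(c • z)) = -(c * dot v z) := by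
  simp [dot]; ring

namespace NearOrbit

variable {k : Fin 2 → ℤ} {u : Plane} {N M R ε E t : ℝ} {h f H1 H2 H3 F1 F2 F3}
  {θ I : ℝ → Plane}

theorem hasDerivWithinAt_freq (O : NearOrbit R k u M ε E t f H1 H2 F1 θ I)
    (hh : HasJet (actionBall R) h H1 H2 H3) {s : ℝ} (hs : s ∈ Icc 0 t) :
    HasDerivWithinAt (fun s => H1 (I s) (toPlane k))
      (H2 (I s) (-(ε • gradVec (F1 (θ s)))) (toPlane k)) (Icc 0 t) s := by
  have := (hh.d2 (I s) (O.mem s hs)).comp_hasDerivWithinAt s (O.action s hs) O.mem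
  simpa using! this.clm_apply (hasDerivWithinAt_const s (Icc 0 t) (toPlane k))

theorem hasDerivWithinAt_hess (O : NearOrbit R k u M ε E t f H1 H2 F1 θ I)
    (hh : HasJet (actionBall R) h H1 H2 H3) {s : ℝ} (hs : s ∈ Icc 0 t) :
    HasDerivWithinAt (fun s => H2 (I s) (toPlane k) u)
      (H3 (I s) (-(ε • gradVec (F1 (θ s)))) (toPlane k) u) (Icc 0 t) s := by
  have := (hh.d3 (I s) (O.mem s hs)).comp_hasDerivWithinAt s (O.action s hs) O.mem
  have h2 := this.clm_apply (hasDerivWithinAt_const s (Icc 0 t) (toPlane k))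
  simpa using! h2.clm_apply (hasDerivWithinAt_const s (Icc 0 t) u)

theorem freq_ne (O : NearOrbit R k u M ε E t f H1 H2 F1 θ I) (hM : 0 < M) {s : ℝ}
    (hs : s ∈ Icc 0 t) : H1 (I s) (toPlane k) ≠ 0 := by
  have := (one_div_pos.2 hM).trans_le (O.freq s hs)
  exact abs_pos.1 this

theorem abs_inv_freq (O : NearOrbit R k u M ε E t f H1 H2 F1 θ I) (hM : 0 < M) {s : ℝ}
    (hs : s ∈ Icc 0 t) : |(H1 (I s) (toPlane k))⁻¹| ≤ M := by
  rw [abs_inv]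
  have := inv_anti₀ (one_div_pos.2 hM) (O.freq s hs)
  simpa using this

theorem norm_velocity_le (hf : HasJet univ f F1 F2 F3) (hε : 0 < ε) (x : Plane) :
    ‖-(ε • gradVec (F1 x))‖ ≤ 2 * ε := by
  rw [norm_neg, norm_smul, Real.norm_eq_abs, abs_of_pos hε, mul_comm]
  exact mul_le_mul_of_nonneg_right ((norm_gradVec_le _).trans (hf.b1 x (mem_univ x))) hε.le

/-- The derivative of a corrector along the orbit. -/
theorem hasDerivWithinAt_corrector (O : NearOrbit R k u M ε E t f H1 H2 F1 θ I)
    (F : Frame k u N M) {P : Plane → ℝ} {P' : Plane → Plane →L[ℝ] ℝ} {C : ℝ}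
    (hP : ∀ x, HasFDerivAt P (P' x) x) (hc : Continuous P') (hb : ∀ x, ‖P' x‖ ≤ C)
    (hper : ∀ (m : Fin 2 → ℤ) θ, P (θ + toPlane m) = P θ) {s : ℝ} (hs : s ∈ Icc 0 t) :
    HasDerivWithinAt (fun s => N * corrector (toPlane k) P (θ s))
      (H1 (I s) u * correctorDeriv (toPlane k) P' (θ s) u
        + H1 (I s) (toPlane k) * (P (θ s) - kAverage k P (θ s))) (Icc 0 t) s := by
  have hN : N ≠ 0 := (zero_lt_one.trans_le F.one_le).ne'
  have h1 := (hasFDerivAt_corrector hP hc hb (toPlane k) (θ s)).comp_hasDerivWithinAt s (O.angle s hs)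
  refine (h1.const_mul N).congr_deriv ?_
  rw [F.apply_gradVec, correctorDeriv_apply_self hP hc hper]
  field_simp

/-- Along the orbit the slow angle stays close to its initial value. -/
theorem abs_slow_angle_sub_le (O : NearOrbit R k u M ε E t f H1 H2 F1 θ I) (F : Frame k u N M)
    (hh : HasJet (actionBall R) h H1 H2 H3) (hf : HasJet univ f F1 F2 F3)
    (hper : ∀ (m : Fin 2 → ℤ) θ, f (θ + toPlane m) = f θ) (hε : 0 < ε) {θs : Plane}
    (hE : E = kAverage k f θs) (h0 : dot u (θ 0) = dot u θs) {T : ℝ} (hT : t * ε ≤ T) :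
    ∀ s ∈ Icc 0 t, |dot u (θ s) - dot u θs| ≤ M ^ 9 * Real.exp (M ^ 6 * T) * ε := by
  have hM := F.eight_le
  have hM0 : 0 < M := by linarith
  have hM1 : 1 ≤ M := by linarith
  have hN0 : 0 < N := zero_lt_one.trans_le F.one_le
  have hP : ∀ x, HasFDerivAt f (F1 x) x := fun x => (hf.d1 x (mem_univ x)).hasFDerivAt univ_mem
  have hc := (jet_continuous hf).2.1
  have hb1 : ∀ x, ‖F1 x‖ ≤ 2 := fun x => hf.b1 x (mem_univ x)
  have hb0 : ∀ x, |f x| ≤ 1 := fun x => hf.b0 x (mem_univ x)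
  have lipf : ∀ x y, |f x - f y| ≤ 2 * ‖x - y‖ := fun x y =>
    lipschitz_of_deriv_bound convex_univ hf.d1 hf.b1 x (mem_univ x) y (mem_univ y)
  set W : ℝ → ℝ := fun s => H1 (I s) (toPlane k) with hWdef
  set K : ℝ → ℝ := fun s => H2 (I s) (toPlane k) u with hKdef
  set W' : ℝ → ℝ := fun s => H2 (I s) (-(ε • gradVec (F1 (θ s)))) (toPlane k) with hW'def
  set K' : ℝ → ℝ := fun s => H3 (I s) (-(ε • gradVec (F1 (θ s)))) (toPlane k) u with hK'def
  set G : ℝ → ℝ := fun s => N * corrector (toPlane k) f (θ s) with hGdef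
  set D : ℝ → ℝ := fun s => correctorDeriv (toPlane k) F1 (θ s) u with hDdef
  set r : ℝ → ℝ := fun s => K s * ((W s)⁻¹ * (W s)⁻¹) with hrdef
  set r' : ℝ → ℝ := fun s => K' s * ((W s)⁻¹ * (W s)⁻¹)
    + K s * (-W' s * (W s)⁻¹ * (W s)⁻¹ * (W s)⁻¹ + (W s)⁻¹ * (-W' s * (W s)⁻¹ * (W s)⁻¹)) with hr'def
  set A : ℝ → ℝ := fun s => f (θ s) - kAverage k f (θ s) with hAdef
  set z : ℝ → ℝ := fun s => dot u (θ s) - dot u θs + ε * (r s * G s) with hzdef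
  set z' : ℝ → ℝ := fun s => H1 (I s) u + ε * (r' s * G s
    + r s * (H1 (I s) u * D s + W s * A s)) with hz'def
  have bK : ∀ s ∈ Icc 0 t, |K s| ≤ M ^ 3 := fun s hs =>
    (abs_apply₂_le (hh.b2 _ (O.mem s hs)) F.norm_k F.norm_u).trans
        ((by ring : 4 * M * M = 4 * M ^ 2).trans_le (const_mul_pow_le hM 2 1 3 rfl (by norm_num)))
  have bv : ∀ s ∈ Icc 0 t, |(W s)⁻¹| ≤ M := fun s hs => O.abs_inv_freq hM0 hs
  have bW' : ∀ s ∈ Icc 0 t, |W' s| ≤ M ^ 2 * ε := fun s hs => by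
    refine (abs_apply₂_le (hh.b2 _ (O.mem s hs)) (norm_velocity_le hf hε _) F.norm_k).trans ?_
    have := const_mul_pow_le hM 1 1 2 rfl (c := 8) (by norm_num)
    nlinarith
  have bK' : ∀ s ∈ Icc 0 t, |K' s| ≤ M ^ 4 * ε := fun s hs => by
    refine (abs_apply₃_le (hh.b3 _ (O.mem s hs)) (norm_velocity_le hf hε _) F.norm_k F.norm_u).trans ?_
    have := const_mul_pow_le hM 2 2 4 rfl (c := 16) (by norm_num)
    nlinarith
  have bG : ∀ s, |G s| ≤ M := fun s =>
    (abs_mul_le_mul ((abs_of_pos hN0).trans_le F.le) (abs_corrector_le hb0 (toPlane k) (θ s))).trans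
      (le_of_eq (mul_one M))
  have bD : ∀ s, |D s| ≤ M ^ 2 := fun s =>
    (abs_apply_le (norm_correctorDeriv_le hb1 _ _) F.norm_u).trans (by nlinarith)
  have br : ∀ s ∈ Icc 0 t, |r s| ≤ M ^ 5 := fun s hs =>
    (abs_mul_le_mul (bK s hs) (abs_mul_le_mul (bv s hs) (bv s hs))).trans (le_of_eq (by ring))
  have brG : ∀ s ∈ Icc 0 t, |ε * (r s * G s)| ≤ M ^ 6 * ε := fun s hs =>
    (abs_mul_le_mul (abs_of_pos hε).le (abs_mul_le_mul (br s hs) (bG s))).trans (le_of_eq (by ring))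
  have br' : ∀ s ∈ Icc 0 t, |r' s| ≤ M ^ 9 * ε := fun s hs => by
    have hn : |-W' s| ≤ M ^ 2 * ε := by rw [abs_neg]; exact bW' s hs
    have a1 := abs_mul_le_mul (bK' s hs) (abs_mul_le_mul (bv s hs) (bv s hs))
    have a2 := abs_mul_le_mul (abs_mul_le_mul hn (bv s hs)) (bv s hs)
    have a3 := abs_mul_le_mul (bK s hs) ((abs_add_le _ _).trans
      (add_le_add (abs_mul_le_mul a2 (bv s hs)) (abs_mul_le_mul (bv s hs) a2)))
    refine (abs_add_le _ _).trans ((add_le_add a1 a3).trans ?_)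
    have e1 : M ^ 6 ≤ M ^ 8 := pow_le_pow_right₀ hM1 (by norm_num)
    have e2 := const_mul_pow_le hM 8 1 9 rfl (c := 3) (by norm_num)
    have e3 : M ^ 4 * ε * (M * M) + M ^ 3 * (M ^ 2 * ε * M * M * M + M * (M ^ 2 * ε * M * M))
      = M ^ 6 * ε + 2 * M ^ 8 * ε := by ring
    rw [e3]
    nlinarith
  have hz : ∀ s ∈ Icc 0 t, HasDerivWithinAt z (z' s) (Icc 0 t) s := by
    intro s hs
    have hW0 : W s ≠ 0 := O.freq_ne hM0 hs
    have dW : HasDerivWithinAt W (W' s) (Icc 0 t) s := O.hasDerivWithinAt_freq hh hs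
    have dv : HasDerivWithinAt (fun s => (W s)⁻¹) (-W' s * (W s)⁻¹ * (W s)⁻¹) (Icc 0 t) s :=
      (dW.inv hW0).congr_deriv (by field_simp)
    have dr := (O.hasDerivWithinAt_hess hh hs).mul (dv.mul dv)
    have dG := O.hasDerivWithinAt_corrector F hP hc hb1 hper hs
    have db := (hasDerivWithinAt_dot (v := u) (O.angle s hs)).sub_const (dot u θs)
    rw [dot_gradVec] at db
    exact db.add ((dr.mul dG).const_mul ε)
  have hclose : ∀ s ∈ Icc 0 t, |dot u (θ s) - dot u θs| ≤ |z s| + M ^ 6 * ε := fun s hs => by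
    have e : dot u (θ s) - dot u θs = z s - ε * (r s * G s) := by simp only [hzdef]; ring
    rw [e]
    exact (abs_sub _ _).trans (by linarith [brG s hs])
  have hz'le : ∀ s ∈ Icc 0 t, |z' s| ≤ (M ^ 6 * ε) * |z s| + M ^ 14 * ε ^ 2 := by
    intro s hs
    have hW0 : W s ≠ 0 := O.freq_ne hM0 hs
    have e : z' s = ε * (K s * (W s)⁻¹ * (E - kAverage k f (θ s)))
        + ((W s)⁻¹ * (H1 (I s) u * W s - ε * K s * (E - f (θ s)))
          + ε * (r' s * G s) + ε * (r s * (H1 (I s) u * D s))) := by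
      simp only [hz'def, hAdef, hrdef]
      field_simp
      ring
    have a1 := abs_mul_le_mul (bv s hs) (O.slope s hs)
    have a2 := abs_mul_le_mul (abs_of_pos hε).le (abs_mul_le_mul (br' s hs) (bG s))
    have a3 := abs_mul_le_mul (abs_of_pos hε).le
      (abs_mul_le_mul (br s hs) (abs_mul_le_mul (O.slow s hs) (bD s)))
    have a4 : |E - kAverage k f (θ s)| ≤ M ^ 2 * (|z s| + M ^ 6 * ε) := by
      rw [hE, abs_sub_comm]
      refine (F.abs_kAverage_sub_le (jet_continuous hf).1 (by norm_num) lipf hper _ _).trans ?_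
      exact mul_le_mul (by nlinarith) (hclose s hs) (abs_nonneg _) (by positivity)
    have a5 := abs_mul_le_mul (abs_of_pos hε).le
      (abs_mul_le_mul (abs_mul_le_mul (bK s hs) (bv s hs)) a4)
    rw [e]
    refine (abs_add_le _ _).trans ((add_le_add a5 ((abs_add_le _ _).trans
      (add_le_add ((abs_add_le _ _).trans (add_le_add a1 a2)) a3))).trans ?_)
    have e1 : M ^ 10 ≤ M ^ 12 := pow_le_pow_right₀ hM1 (by norm_num)
    have e2 := const_mul_pow_le hM 12 1 13 rfl (c := 4) (by norm_num)
    have e3 : M ^ 13 ≤ M ^ 14 := pow_le_pow_right₀ hM1 (by norm_num)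
    have e4 : ε * (M ^ 3 * M * (M ^ 2 * (|z s| + M ^ 6 * ε))) + (M * (M ^ 11 * ε ^ 2)
      + ε * (M ^ 9 * ε * M) + ε * (M ^ 5 * (M ^ 5 * ε * M ^ 2)))
      = M ^ 6 * ε * |z s| + (3 * M ^ 12 + M ^ 10) * ε ^ 2 := by ring
    rw [e4]
    have e5 : 3 * M ^ 12 + M ^ 10 ≤ M ^ 14 := by linarith
    have := mul_le_mul_of_nonneg_right e5 (sq_nonneg ε)
    linarith
  have hz0 : ∀ s ∈ Icc 0 t, |z 0| ≤ M ^ 6 * ε := fun s hs => by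
    have : z 0 = ε * (r 0 * G 0) := by simp only [hzdef]; rw [h0]; ring
    rw [this]
    exact brG 0 ⟨le_rfl, hs.1.trans hs.2⟩
  intro s hs
  have hCpos : 0 < M ^ 6 * ε := by positivity
  have hg := abs_le_of_gronwall hCpos hz (hz0 s hs) hz'le s hs
  have hexp : Real.exp (M ^ 6 * ε * s) ≤ Real.exp (M ^ 6 * T) := by
    refine Real.exp_le_exp.2 ?_
    rw [mul_assoc]
    refine mul_le_mul_of_nonneg_left ?_ (by positivity)
    nlinarith [hs.2]
  have hdiv : M ^ 14 * ε ^ 2 / (M ^ 6 * ε) = M ^ 8 * ε := by field_simp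
  rw [hdiv] at hg
  have e1 : M ^ 6 ≤ M ^ 8 := pow_le_pow_right₀ hM1 (by norm_num)
  have e2 := const_mul_pow_le hM 8 1 9 rfl (c := 2) (by norm_num)
  have hEpos := Real.exp_pos (M ^ 6 * T)
  have g1 := mul_le_mul_of_nonneg_left hexp hCpos.le
  have g2 := mul_le_mul_of_nonneg_left hexp (by positivity : 0 ≤ M ^ 8 * ε)
  have g3 := hclose s hs
  have g4 := mul_le_mul_of_nonneg_right e1 (by positivity : 0 ≤ Real.exp (M ^ 6 * T) * ε)
  have g5 := mul_le_mul_of_nonneg_right e2 (by positivity : 0 ≤ Real.exp (M ^ 6 * T) * ε)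
  have g6 := mul_le_mul_of_nonneg_right e1 hε.le
  linarith

/-- Along the orbit the slow action drifts at a rate of order `ε`. -/
theorem drift_le (O : NearOrbit R k u M ε E t f H1 H2 F1 θ I) (F : Frame k u N M)
    (hh : HasJet (actionBall R) h H1 H2 H3) (hf : HasJet univ f F1 F2 F3)
    (hper : ∀ (m : Fin 2 → ℤ) θ, f (θ + toPlane m) = f θ) (hε : 0 < ε) (ht : 0 ≤ t) {θs : Plane}
    {lam B : ℝ} (hlam : kAverage k (fun x => F1 x u) θs ≤ -lam) (hB : 1 ≤ B)
    (hangle : ∀ s ∈ Icc 0 t, |dot u (θ s) - dot u θs| ≤ M ^ 9 * B * ε)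
    (hsmall : 2 * M ^ 13 * B * ε ≤ lam) :
    dot u (I 0) + ε * lam / 2 * t - 2 * M ^ 4 * ε ≤ dot u (I t) := by
  have hM := F.eight_le
  have hM0 : 0 < M := by linarith
  have hM1 : 1 ≤ M := by linarith
  have hN0 : 0 < N := zero_lt_one.trans_le F.one_le
  set P : Plane → ℝ := fun x => F1 x u with hPdef
  set P' : Plane → Plane →L[ℝ] ℝ := fun x => (F2 x).flip u with hP'def
  have hP : ∀ x, HasFDerivAt P (P' x) x := fun x => by
    have := ((hf.d2 x (mem_univ x)).hasFDerivAt univ_mem).clm_apply (hasFDerivAt_const u x)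
    refine this.congr_fderiv ?_
    ext v; simp [hP'def]
  have hc : Continuous P' :=
    ((ContinuousLinearMap.flipₗᵢ ℝ Plane Plane ℝ).continuous.comp
      (jet_continuous hf).2.2).clm_apply continuous_const
  have hPc : Continuous P := (jet_continuous hf).2.1.clm_apply continuous_const
  have hb0 : ∀ x, |P x| ≤ M ^ 2 := fun x =>
    (abs_apply_le (hf.b1 x (mem_univ x)) F.norm_u).trans (by nlinarith)
  have hb1 : ∀ x, ‖P' x‖ ≤ M ^ 2 := fun x => by
    refine ((F2 x).flip.le_opNorm u).trans ?_
    rw [ContinuousLinearMap.opNorm_flip]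
    exact (mul_le_mul (hf.b2 x (mem_univ x)) F.norm_u (norm_nonneg _) (by norm_num)).trans
      (by nlinarith)
  have hperP : ∀ (m : Fin 2 → ℤ) θ, P (θ + toPlane m) = P θ := fun m x => by
    have e : F1 (x + toPlane m) = F1 x := by
      have h1 : HasFDerivAt (fun y => f (y + toPlane m)) (F1 (x + toPlane m)) x := by
        simpa [Function.comp_def] using! ((hf.d1 (x + toPlane m) (mem_univ _)).hasFDerivAt
          univ_mem).comp x ((hasFDerivAt_id x).add_const (toPlane m))
      simp only [hper] at h1
      exact h1.unique ((hf.d1 x (mem_univ x)).hasFDerivAt univ_mem)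
    simp only [hPdef, e]
  have lipP : ∀ x y, |P x - P y| ≤ M ^ 2 * ‖x - y‖ := fun x y =>
    lipschitz_of_deriv_bound convex_univ (fun z _ => (hP z).hasFDerivWithinAt)
      (fun z _ => hb1 z) x (mem_univ x) y (mem_univ y)
  set W : ℝ → ℝ := fun s => H1 (I s) (toPlane k) with hWdef
  set W' : ℝ → ℝ := fun s => H2 (I s) (-(ε • gradVec (F1 (θ s)))) (toPlane k) with hW'def
  set G : ℝ → ℝ := fun s => N * corrector (toPlane k) P (θ s) with hGdef
  set D : ℝ → ℝ := fun s => correctorDeriv (toPlane k) P' (θ s) u with hDdef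
  set z : ℝ → ℝ := fun s => dot u (I s) + ε * ((W s)⁻¹ * G s) with hzdef
  set z' : ℝ → ℝ := fun s => -(ε * P (θ s)) + ε * (-W' s * (W s)⁻¹ * (W s)⁻¹ * G s
    + (W s)⁻¹ * (H1 (I s) u * D s + W s * (P (θ s) - kAverage k P (θ s)))) with hz'def
  have bv : ∀ s ∈ Icc 0 t, |(W s)⁻¹| ≤ M := fun s hs => O.abs_inv_freq hM0 hs
  have bW' : ∀ s ∈ Icc 0 t, |-W' s| ≤ M ^ 2 * ε := fun s hs => by
    rw [abs_neg]
    refine (abs_apply₂_le (hh.b2 _ (O.mem s hs)) (norm_velocity_le hf hε _) F.norm_k).trans ?_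
    have := const_mul_pow_le hM 1 1 2 rfl (c := 8) (by norm_num)
    nlinarith
  have bG : ∀ s, |G s| ≤ M ^ 3 := fun s =>
    (abs_mul_le_mul ((abs_of_pos hN0).trans_le F.le) (abs_corrector_le hb0 (toPlane k) (θ s))).trans
      (le_of_eq (by ring))
  have bD : ∀ s, |D s| ≤ M ^ 3 := fun s =>
    (abs_apply_le (norm_correctorDeriv_le hb1 _ _) F.norm_u).trans (le_of_eq (by ring))
  have bvG : ∀ s ∈ Icc 0 t, |ε * ((W s)⁻¹ * G s)| ≤ M ^ 4 * ε := fun s hs =>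
    (abs_mul_le_mul (abs_of_pos hε).le (abs_mul_le_mul (bv s hs) (bG s))).trans (le_of_eq (by ring))
  have hz : ∀ s ∈ Icc 0 t, HasDerivWithinAt z (z' s) (Icc 0 t) s := by
    intro s hs
    have hW0 : W s ≠ 0 := O.freq_ne hM0 hs
    have dW : HasDerivWithinAt W (W' s) (Icc 0 t) s := O.hasDerivWithinAt_freq hh hs
    have dv : HasDerivWithinAt (fun s => (W s)⁻¹) (-W' s * (W s)⁻¹ * (W s)⁻¹) (Icc 0 t) s :=
      (dW.inv hW0).congr_deriv (by field_simp)
    have dG := O.hasDerivWithinAt_corrector F hP hc hb1 hperP hs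
    have db := hasDerivWithinAt_dot (v := u) (O.action s hs)
    rw [dot_neg_smul, dot_gradVec] at db
    exact db.add ((dv.mul dG).const_mul ε)
  have hz'le : ∀ s ∈ Icc 0 t, 0 ≤ z' s - ε * lam / 2 := by
    intro s hs
    have hW0 : W s ≠ 0 := O.freq_ne hM0 hs
    have e : z' s = ε * (-kAverage k P θs) - ε * (kAverage k P (θ s) - kAverage k P θs)
        + ε * (-W' s * (W s)⁻¹ * (W s)⁻¹ * G s + (W s)⁻¹ * (H1 (I s) u * D s)) := by
      simp only [hz'def]
      field_simp
      ring
    have a1 := abs_mul_le_mul (abs_mul_le_mul (abs_mul_le_mul (bW' s hs) (bv s hs)) (bv s hs)) (bG s)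
    have a2 := abs_mul_le_mul (bv s hs) (abs_mul_le_mul (O.slow s hs) (bD s))
    have a3 := (F.abs_kAverage_sub_le hPc (by positivity) lipP hperP (θ s) θs).trans
      (mul_le_mul_of_nonneg_left (hangle s hs) (by positivity))
    have b1 := abs_le.1 ((abs_add_le _ _).trans (add_le_add a1 a2))
    have b3 := abs_le.1 a3
    have e1 : M ^ 7 ≤ M ^ 12 := pow_le_pow_right₀ hM1 (by norm_num)
    have e2 : M ^ 9 ≤ M ^ 12 := pow_le_pow_right₀ hM1 (by norm_num)
    have e3 := const_mul_pow_le hM 12 1 13 rfl (c := 3) (by norm_num)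
    have hle : M ^ 2 * M * (M ^ 9 * B * ε) + (M ^ 2 * ε * M * M * M ^ 3 + M * (M ^ 5 * ε * M ^ 3))
        ≤ lam / 2 := by
      have c1 : M ^ 12 ≤ M ^ 12 * B := le_mul_of_one_le_right (by positivity) hB
      have c2 : M ^ 12 * B + M ^ 7 + M ^ 9 ≤ M ^ 13 * B := by
        have := mul_le_mul_of_nonneg_right e3 (zero_le_one.trans hB)
        linarith
      have c3 := mul_le_mul_of_nonneg_right c2 hε.le
      linarith
    rw [e]
    have : 0 ≤ ε * ((-kAverage k P θs) - (kAverage k P (θ s) - kAverage k P θs)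
        + (-W' s * (W s)⁻¹ * (W s)⁻¹ * G s + (W s)⁻¹ * (H1 (I s) u * D s)) - lam / 2) := by
      refine mul_nonneg hε.le ?_
      linarith [b1.1, b3.2]
    linarith
  have hmono := le_of_deriv_nonneg (g := fun s => z s - ε * lam / 2 * s)
    (g' := fun s => z' s - ε * lam / 2) ht (fun s hs => by
      simpa using! (hz s hs).sub ((hasDerivWithinAt_id s (Icc 0 t)).const_mul (ε * lam / 2))) hz'le
  have c0 := abs_le.1 (bvG 0 ⟨le_rfl, ht⟩)
  have c1 := abs_le.1 (bvG t ⟨ht, le_rfl⟩)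
  simp only [hzdef, mul_zero, sub_zero] at hmono
  linarith [c0.1, c1.2]

end NearOrbit

/-- The signed distance to the resonant line, in units of `k`. -/
noncomputable def offset (k : Fin 2 → ℤ) (a N : ℝ) (I : Plane) : ℝ := (dot (toPlane k) I + a) / N

theorem dot_add (v x y : Plane) : dot v (x + y) = dot v x + dot v y := by simp [dot]; ring

theorem dot_sub (v x y : Plane) : dot v (x - y) = dot v x - dot v y := by simp [dot]; ring

theorem dot_smul (v x : Plane) (c : ℝ) : dot v (c • x) = c * dot v x := by simp [dot]; ring

theorem continuous_dot (v : Plane) : Continuous (dot v) := by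
  unfold dot; fun_prop

theorem abs_dot_le (v x : Plane) : |dot v x| ≤ 2 * ‖v‖ * ‖x‖ := by
  have h : ∀ i, |v i * x i| ≤ ‖v‖ * ‖x‖ := fun i =>
    abs_mul_le_mul (norm_le_pi_norm v i) (norm_le_pi_norm x i)
  exact (abs_add_le _ _).trans (by linarith [h 0, h 1])

namespace Frame

variable {k : Fin 2 → ℤ} {u : Plane} {N M a : ℝ}

theorem eq_of_mem_line (F : Frame k u N M) {e : Plane} (he : e ∈ resonantLine k a) (I : Plane) :
    I = e + ((dot u I - dot u e) / N) • u + offset k a N I • toPlane k := by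
  have h := F.decomp (I - e)
  have he' : dot (toPlane k) e = -a := by
    have : (k 0 : ℝ) * e 0 + (k 1 : ℝ) * e 1 + a = 0 := he
    simp only [dot, toPlane]; linarith
  rw [dot_sub, dot_sub, he', sub_neg_eq_add] at h
  rw [offset, add_assoc, ← h]; abel

theorem offset_eq_zero {e : Plane} (he : e ∈ resonantLine k a) : offset k a N e = 0 := by
  have : (k 0 : ℝ) * e 0 + (k 1 : ℝ) * e 1 + a = 0 := he
  simp only [offset, dot, toPlane, this, zero_div]

theorem add_smul_mem_line (F : Frame k u N M) {e : Plane} (he : e ∈ resonantLine k a) (c : ℝ) :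
    e + c • u ∈ resonantLine k a := by
  have h1 : (k 0 : ℝ) * e 0 + (k 1 : ℝ) * e 1 + a = 0 := he
  have h2 := F.dot_k
  simp only [dot, toPlane] at h2
  change (k 0 : ℝ) * (e + c • u) 0 + (k 1 : ℝ) * (e + c • u) 1 + a = 0
  simp only [Pi.add_apply, Pi.smul_apply, smul_eq_mul]
  linear_combination h1 + c * h2

theorem foot_mem_segment (F : Frame k u N M) {p : Plane} {σ : ℝ} (hσ : 0 < σ)
    (hp : p ∈ resonantLine k a) {I : Plane} (h1 : dot u p ≤ dot u I)
    (h2 : dot u I ≤ dot u (p + σ • u)) :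
    I - offset k a N I • toPlane k ∈ segment ℝ p (p + σ • u) := by
  have hN : 0 < N := zero_lt_one.trans_le F.one_le
  have e : I - offset k a N I • toPlane k = p + ((dot u I - dot u p) / N) • u :=
    sub_eq_of_eq_add (F.eq_of_mem_line hp I)
  rw [dot_add, dot_smul, F.dot_self] at h2
  rw [e, segment_eq_image']
  refine ⟨(dot u I - dot u p) / (N * σ), ⟨?_, ?_⟩, ?_⟩
  · exact div_nonneg (by linarith) (by positivity)
  · rw [div_le_one (by positivity)]; linarith
  · simp only [add_sub_cancel_left, smul_smul]
    congr 2
    field_simp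

/-- Points close to the resonant line and far from the ends of a segment on it are in `B_R`. -/
theorem mem_actionBall (F : Frame k u N M) {R r ε lam : ℝ} (hR : 0 < R) (hr : 0 < r) (hε : 0 < ε)
    {z e I : Plane} (hz : z ∈ resonantLine k a) (hzr : Metric.closedBall z r ⊆ actionBall R)
    (he : e ∈ resonantLine k a) (heB : e ∈ actionBall R) (hl0 : 0 ≤ lam) (hl1 : lam ≤ 1)
    (hI : dot u I - dot u e = lam * (dot u z - dot u e))
    (hd : 32 * M ^ 3 * R / r * ε ≤ |dot u I - dot u e|)
    (hY : |offset k a N I| ≤ 8 * M * ε) : I ∈ actionBall R := by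
  have hM := F.eight_le
  have hM0 : 0 < M := by linarith
  have hN : 0 < N := zero_lt_one.trans_le F.one_le
  have hze : z = e + ((dot u z - dot u e) / N) • u := by
    have := F.eq_of_mem_line he z
    rwa [offset_eq_zero hz, zero_smul, add_zero] at this
  have hzB : z ∈ actionBall R := hzr (Metric.mem_closedBall_self hr.le)
  have hΛ : |dot u z - dot u e| ≤ 4 * M * R := by
    rw [← dot_sub]
    refine (abs_dot_le _ _).trans ?_
    have h1 : ‖z - e‖ ≤ 2 * R := (norm_sub_le _ _).trans (by
      have := mem_closedBall_zero_iff.1 hzB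
      have := mem_closedBall_zero_iff.1 heB
      linarith)
    calc 2 * ‖u‖ * ‖z - e‖ ≤ 2 * M * (2 * R) :=
          mul_le_mul (by linarith [F.norm_u]) h1 (norm_nonneg _) (by positivity)
      _ = _ := by ring
  have hlr : 8 * M ^ 2 * ε ≤ lam * r := by
    have h1 : 32 * M ^ 3 * R / r * ε ≤ lam * (4 * M * R) := by
      refine hd.trans ?_
      rw [hI, abs_mul, abs_of_nonneg hl0]
      exact mul_le_mul_of_nonneg_left hΛ hl0
    have h2 : 32 * M ^ 3 * R / r * ε = (8 * M ^ 2 * ε / r) * (4 * M * R) := by ring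
    rw [h2] at h1
    have h3 := le_of_mul_le_mul_right h1 (by positivity)
    rwa [div_le_iff₀ hr] at h3
  have hl : 0 < lam := pos_of_mul_pos_left ((by positivity : 0 < 8 * M ^ 2 * ε).trans_le hlr) hr.le
  have hv : ‖offset k a N I • toPlane k‖ ≤ lam * r := by
    rw [norm_smul, Real.norm_eq_abs]
    refine le_trans ?_ hlr
    calc _ ≤ 8 * M * ε * M := mul_le_mul hY F.norm_k (norm_nonneg _) (by positivity)
      _ = _ := by ring
  have hz' : z + lam⁻¹ • (offset k a N I • toPlane k) ∈ actionBall R := by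
    refine hzr ?_
    rw [mem_closedBall_iff_norm, add_sub_cancel_left, norm_smul, norm_inv, Real.norm_eq_abs,
      abs_of_pos hl, inv_mul_le_iff₀ hl]
    exact hv
  have := convex_actionBall R hz' heB hl0 (sub_nonneg.2 hl1) (by ring)
  convert this using 1
  conv_lhs => rw [F.eq_of_mem_line he I, hI]
  rw [smul_add, smul_smul lam, mul_inv_cancel₀ hl.ne', one_smul]
  conv_rhs => rw [hze]
  rw [smul_add, smul_smul, mul_div_assoc, sub_smul, one_smul]
  abel

end Frame

theorem exists_frame {k : Fin 2 → ℤ} (hk : k ≠ 0) {u : Plane} {s N M : ℝ} (hs : s ^ 2 = 1)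
    (h0 : u 0 = s * k 1) (h1 : u 1 = -(s * k 0)) (hN : N = (k 0 : ℝ) ^ 2 + (k 1 : ℝ) ^ 2)
    (hM : 8 + N ≤ M) : Frame k u N M := by
  have hN1 : 1 ≤ N := by
    have h : 0 < k 0 ^ 2 + k 1 ^ 2 := by
      by_contra hc
      have a0 : k 0 = 0 := by nlinarith [sq_nonneg (k 0), sq_nonneg (k 1)]
      have a1 : k 1 = 0 := by nlinarith [sq_nonneg (k 0), sq_nonneg (k 1)]
      exact hk (by ext i; fin_cases i <;> simpa)
    rw [hN]
    exact_mod_cast h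
  have hb : ∀ x : ℝ, x ^ 2 ≤ N → |x| ≤ M := fun x hx => abs_le_of_sq_le_sq (by nlinarith) (by linarith)
  refine ⟨⟨s, hs, h0, h1⟩, hN, hN1, by linarith, ?_, ?_, by linarith⟩
  · refine (pi_norm_le_iff_of_nonneg (by linarith)).2 fun i => hb _ ?_
    fin_cases i
    · simp only [Fin.zero_eta, h0, mul_pow, hs, hN]; nlinarith
    · simp only [Fin.mk_one, h1, neg_sq, mul_pow, hs, hN]; nlinarith
  · refine (pi_norm_le_iff_of_nonneg (by linarith)).2 fun i => hb _ ?_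
    fin_cases i
    · simp only [Fin.zero_eta, toPlane, hN]; nlinarith
    · simp only [Fin.mk_one, toPlane, hN]; nlinarith

/-- While an orbit stays in a box around a resonant segment, its distance to the segment is under
control and its slow action drifts. -/
theorem drift_in_box {k : Fin 2 → ℤ} {u : Plane} {N M R a ε lam σ T t : ℝ} (F : Frame k u N M)
    {h f H1 H2 H3 F1 F2 F3} (hh : HasJet (actionBall R) h H1 H2 H3) (hf : HasJet univ f F1 F2 F3)
    (hper : ∀ (m : Fin 2 → ℤ) θ, f (θ + toPlane m) = f θ) {p : Plane} (hp : p ∈ resonantLine k a)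
    (hσ : 0 < σ) (hseg : segment ℝ p (p + σ • u) ⊆ actionBall R) {e : ℝ}
    (he : ∀ J ∈ segment ℝ p (p + σ • u), h J = e) (hu : ∀ J ∈ segment ℝ p (p + σ • u), H1 J u = 0)
    (hk : ∀ J ∈ segment ℝ p (p + σ • u), 2 / M ≤ |H1 J (toPlane k)|) {θs : Plane}
    (hlam : kAverage k (fun x => F1 x u) θs ≤ -lam) (hε : 0 < ε) (hsmall : 16 * M ^ 5 * ε ≤ 1)
    (hsmall' : 2 * M ^ 13 * Real.exp (M ^ 6 * T) * ε ≤ lam) (hT : 0 ≤ T) (ht : 0 ≤ t)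
    (htT : t * ε ≤ T) {θ I : ℝ → Plane}
    (hθ : ∀ s ∈ Icc 0 t, HasDerivWithinAt θ (gradVec (H1 (I s))) (Icc 0 t) s)
    (hI : ∀ s ∈ Icc 0 t, HasDerivWithinAt I (-(ε • gradVec (F1 (θ s)))) (Icc 0 t) s)
    (hm : ∀ s ∈ Icc 0 t, I s ∈ actionBall R)
    (hC0 : I 0 ∈ segment ℝ p (p + σ • u))
    (hθ0 : f (θ 0) = kAverage k f θs) (hθ0' : dot u (θ 0) = dot u θs)
    (hbox : ∀ s ∈ Icc 0 t, |offset k a N (I s)| ≤ 8 * M * ε ∧ dot u p ≤ dot u (I s) ∧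
      dot u (I s) ≤ dot u (p + σ • u)) :
    |offset k a N (I t)| ≤ 4 * M * ε ∧
      dot u (I 0) + ε * lam / 2 * t - 2 * M ^ 4 * ε ≤ dot u (I t) := by
  have hen := energy_eq hh hf hθ hI hm
  have hnear : ∀ s ∈ Icc 0 t, |offset k a N (I s)| ≤ 4 * M * ε ∧ 1 / M ≤ |H1 (I s) (toPlane k)| ∧
      |H1 (I s) u| ≤ M ^ 5 * ε ∧
      |H1 (I s) u * H1 (I s) (toPlane k) - ε * H2 (I s) (toPlane k) u *
        (kAverage k f θs - f (θ s))| ≤ M ^ 11 * ε ^ 2 := by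
    intro s hs
    obtain ⟨b1, b2, b3⟩ := hbox s hs
    have hJ := F.foot_mem_segment hσ hp b2 b3
    refine near_resonance F hh (hm s hs) (hseg hJ) (by abel) (he _ hJ) (hu _ hJ) (hk _ hJ) hε hsmall b1
      ?_ (hf.b0 _ (mem_univ _)) ?_
    · rw [hen s hs, hθ0, he _ hC0]
    · rw [← hθ0]; exact hf.b0 _ (mem_univ _)
  have O : NearOrbit R k u M ε (kAverage k f θs) t f H1 H2 F1 θ I :=
    ⟨hθ, hI, hm, fun s hs => (hnear s hs).2.1, fun s hs => (hnear s hs).2.2.1,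
      fun s hs => (hnear s hs).2.2.2⟩
  refine ⟨(hnear t ⟨ht, le_rfl⟩).1, ?_⟩
  have hang := O.abs_slow_angle_sub_le F hh hf hper hε rfl hθ0' htT
  exact O.drift_le F hh hf hper hε ht hlam
    (Real.one_le_exp (mul_nonneg (pow_nonneg (by linarith [F.eight_le]) 6) hT)) hang hsmall'

theorem isSolution_of_hasDerivWithinAt {R ε τ : ℝ} (hR : 0 < R) {h f H1 H2 H3 F1 F2 F3}
    (hh : HasJet (actionBall R) h H1 H2 H3) (hf : HasJet univ f F1 F2 F3) {θ I : ℝ → Plane}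
    (hθ : ∀ s ∈ Icc 0 τ, HasDerivWithinAt θ (gradVec (H1 (I s))) (Icc 0 τ) s)
    (hI : ∀ s ∈ Icc 0 τ, HasDerivWithinAt I (-(ε • gradVec (F1 (θ s)))) (Icc 0 τ) s)
    (hm : ∀ s ∈ Icc 0 τ, I s ∈ actionBall R) : IsSolution R (perturbed h f ε) τ θ I := by
  refine ⟨hm, fun t ht i => ?_, fun t ht i => ?_⟩
  · have h1 : HasFDerivWithinAt (fun J => perturbed h f ε (θ t) J) (H1 (I t)) (actionBall R) (I t) :=
      (hh.d1 _ (hm t ht)).add_const _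
    rw [h1.fderivWithin (uniqueDiffOn_actionBall hR _ (hm t ht))]
    exact hasDerivWithinAt_pi.1 (hθ t ht) i
  · have h1 : HasFDerivAt (fun φ => perturbed h f ε φ (I t)) (ε • F1 (θ t)) (θ t) :=
      (((hf.d1 (θ t) (mem_univ _)).hasFDerivAt univ_mem).const_mul ε).const_add _
    rw [h1.fderiv]
    exact hasDerivWithinAt_pi.1 (hI t ht) i

/-- Drift along a segment of a resonant line. -/
theorem exists_drifting_orbit {R : ℝ} {k : Fin 2 → ℤ} {a w : ℝ} (hR : 0 < R) (hk : k ≠ 0)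
    (hw : 0 < w) {z : Plane} (hz : z ∈ resonantLine k a) (hzi : z ∈ interior (actionBall R)) :
    ∃ c : ℝ, 0 < c ∧ ∀ lam σ : ℝ, 0 < lam → 0 < σ → ∃ ε₀ : ℝ, 0 < ε₀ ∧ ε₀ ≤ 1 ∧
      ∀ (h f : Plane → ℝ) (u p : Plane) (s : ℝ), h ∈ unitBallC 10 (actionBall R) →
        f ∈ unitBallTorus 19 → s ^ 2 = 1 → u 0 = s * k 1 → u 1 = -(s * k 0) →
        p ∈ resonantLine k a → p ∈ actionBall R → p + σ • u ∈ actionBall R →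
        (∃ e, ∀ J ∈ segment ℝ p (p + σ • u), h J = e) →
        (∀ J ∈ segment ℝ p (p + σ • u), fderivWithin ℝ h (actionBall R) J u = 0) →
        (∀ J ∈ segment ℝ p (p + σ • u), w ≤ |fderivWithin ℝ h (actionBall R) J (toPlane k)|) →
        ∀ θs : Plane, fderiv ℝ (kAverage k f) θs u ≤ -lam → ∀ ε : ℝ, 0 < ε → ε ≤ ε₀ →
        ∃ (τ : ℝ) (θ I : ℝ → Plane), 0 ≤ τ ∧
          τ ≤ 2 * ((k 0 : ℝ) ^ 2 + (k 1 : ℝ) ^ 2) * σ * lam⁻¹ * ε⁻¹ ∧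
          IsSolution R (perturbed h f ε) τ θ I ∧ ‖I 0 - p‖ ≤ c * ε ∧
          ‖I τ - (p + σ • u)‖ ≤ c * ε ∧
          ∀ t ∈ Icc 0 τ, ∃ J ∈ segment ℝ p (p + σ • u), ‖I t - J‖ ≤ c * ε := by
  obtain ⟨N, hN⟩ : ∃ N : ℝ, N = (k 0 : ℝ) ^ 2 + (k 1 : ℝ) ^ 2 := ⟨_, rfl⟩
  obtain ⟨M, hM⟩ : ∃ M : ℝ, M = 8 + N + 2 / w := ⟨_, rfl⟩
  have hN0 : 0 ≤ N := by rw [hN]; positivity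
  have hw2 : 0 < 2 / w := by positivity
  have hM8 : 8 + N ≤ M := by linarith
  have hM0 : 0 < M := by linarith
  have hwM : 2 / M ≤ w := by
    rw [div_le_iff₀ hM0]
    have : w * (2 / w) = 2 := by field_simp
    nlinarith
  obtain ⟨r, hr, hzr⟩ := Metric.nhds_basis_closedBall.mem_iff.1 (mem_interior_iff_mem_nhds.1 hzi)
  obtain ⟨C2, hC2⟩ : ∃ C2 : ℝ, C2 = 32 * M ^ 3 * R / r := ⟨_, rfl⟩
  obtain ⟨C1, hC1⟩ : ∃ C1 : ℝ, C1 = C2 + 2 * M ^ 4 + 1 := ⟨_, rfl⟩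
  have hC2pos : 0 < C2 := by rw [hC2]; positivity
  have hM4 : 0 < M ^ 4 := by positivity
  have hC1pos : 0 < C1 := by linarith
  refine ⟨C1 * M + 8 * M ^ 2, by positivity, fun lam σ hlam hσ => ?_⟩
  obtain ⟨T, hT⟩ : ∃ T : ℝ, T = 2 * N * σ / lam := ⟨_, rfl⟩
  have hT0 : 0 ≤ T := by rw [hT]; positivity
  have hexp := Real.exp_pos (M ^ 6 * T)
  refine ⟨min (min 1 (1 / (16 * M ^ 5))) (min (lam / (2 * M ^ 13 * Real.exp (M ^ 6 * T)))
    (σ / (4 * C1))), by positivity, (min_le_left _ _).trans (min_le_left _ _), ?_⟩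
  intro h f u p s hhC hfC hs hu0 hu1 hp hpB hqB ⟨e, he⟩ hu hk' θs hθs ε hε hεle
  have hε2 : 16 * M ^ 5 * ε ≤ 1 := by
    have := hεle.trans ((min_le_left _ _).trans (min_le_right _ _))
    rwa [le_div_iff₀ (by positivity), mul_comm] at this
  have hε3 : 2 * M ^ 13 * Real.exp (M ^ 6 * T) * ε ≤ lam := by
    have := hεle.trans ((min_le_right _ _).trans (min_le_left _ _))
    rwa [le_div_iff₀ (by positivity), mul_comm] at this
  have hε4 : 4 * C1 * ε ≤ σ := by
    have := hεle.trans ((min_le_right _ _).trans (min_le_right _ _))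
    rwa [le_div_iff₀ (by positivity), mul_comm] at this
  have F : Frame k u N M := exists_frame hk hs hu0 hu1 hN hM8
  have hNpos : 0 < N := zero_lt_one.trans_le F.one_le
  have hh := hasJet_of_unitBallC (by norm_num) (uniqueDiffOn_actionBall hR) hhC
  have hf := hasJet_of_unitBallC (by norm_num) uniqueDiffOn_univ hfC.1
  set H1 := fderivWithin ℝ h (actionBall R)
  set F1 := fderivWithin ℝ f univ
  have hseg : segment ℝ p (p + σ • u) ⊆ actionBall R := (convex_actionBall R).segment_subset hpB hqB
  have hqL := F.add_smul_mem_line hp σ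
  have hxq : dot u (p + σ • u) = dot u p + σ * N := by rw [dot_add, dot_smul, F.dot_self]
  have hlamF : kAverage k (fun x => F1 x u) θs ≤ -lam := by
    rwa [fderiv_kAverage_apply (fun x => (hf.d1 x (mem_univ x)).hasFDerivAt univ_mem)
      (jet_continuous hf).2.1 (fun x => hf.b1 x (mem_univ x))] at hθs
  -- the initial condition
  obtain ⟨s₀, hs₀⟩ := exists_eq_kAverage (k := k) (jet_continuous hf).1 θs
  have hT' : 0 ≤ T / ε := by positivity
  obtain ⟨θ, I, hθ0, hI0, hθ, hI⟩ := exists_trajectory hR hh hf ε hT' (θs + s₀ • toPlane k)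
    (p + (C1 * ε / N) • u)
  have hxI0 : dot u (I 0) = dot u p + C1 * ε := by
    rw [hI0, dot_add, dot_smul, F.dot_self]; field_simp
  have hoff0 : offset k a N (I 0) = 0 := by
    rw [hI0]; exact Frame.offset_eq_zero (F.add_smul_mem_line hp _)
  have hC1ε : 0 < C1 * ε := by positivity
  have hσN : σ ≤ σ * N := le_mul_of_one_le_right hσ.le F.one_le
  have hI0seg : I 0 ∈ segment ℝ p (p + σ • u) := by
    have := F.foot_mem_segment hσ hp (I := I 0) (by linarith) (by linarith)
    rwa [hoff0, zero_smul, sub_zero] at this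
  have hIcont : ContinuousOn I (Icc 0 (T / ε)) := fun t ht => (hI t ht).continuousWithinAt
  set m : ℝ → ℝ := fun t => min (8 * M * ε - |offset k a N (I t)|)
    (min (dot u (I t) - dot u p - C2 * ε) (dot u (p + σ • u) - C1 * ε - dot u (I t))) with hmdef
  have hmcont : ContinuousOn m (Icc 0 (T / ε)) := by
    have c1 : ContinuousOn (fun t => dot u (I t)) (Icc 0 (T / ε)) :=
      (continuous_dot u).comp_continuousOn hIcont
    have c2 : ContinuousOn (fun t => offset k a N (I t)) (Icc 0 (T / ε)) :=
      (((continuous_dot (toPlane k)).comp_continuousOn hIcont).add continuousOn_const).div_const N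
    have c3 : ContinuousOn (fun t => 8 * M * ε - |offset k a N (I t)|) (Icc 0 (T / ε)) :=
      continuousOn_const.sub c2.abs
    have c4 : ContinuousOn (fun t => dot u (I t) - dot u p - C2 * ε) (Icc 0 (T / ε)) :=
      (c1.sub continuousOn_const).sub continuousOn_const
    have c5 : ContinuousOn (fun t => dot u (p + σ • u) - C1 * ε - dot u (I t)) (Icc 0 (T / ε)) :=
      continuousOn_const.sub c1
    exact ContinuousOn.inf c3 (ContinuousOn.inf c4 c5)
  have hbox : ∀ t, 0 ≤ m t → |offset k a N (I t)| ≤ 8 * M * ε ∧ dot u p + C2 * ε ≤ dot u (I t) ∧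
      dot u (I t) ≤ dot u (p + σ • u) - C1 * ε := by
    intro t ht
    obtain ⟨h1, h2⟩ := le_min_iff.1 ht
    obtain ⟨h2, h3⟩ := le_min_iff.1 h2
    exact ⟨by linarith, by linarith, by linarith⟩
  have hC2ε : 0 < C2 * ε := by positivity
  have hC21 : C2 * ε < C1 * ε := mul_lt_mul_of_pos_right (by linarith) hε
  have hball : ∀ t, 0 ≤ m t → I t ∈ actionBall R := by
    intro t ht
    obtain ⟨b1, b2, b3⟩ := hbox t ht
    rcases le_total (dot u (I t)) (dot u z) with hle | hle
    · have hpos : 0 < dot u z - dot u p := by linarith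
      refine F.mem_actionBall hR hr hε hz hzr hp hpB
        (lam := (dot u (I t) - dot u p) / (dot u z - dot u p)) (div_nonneg (by linarith) hpos.le)
        ((div_le_one hpos).2 (by linarith)) (by field_simp) ?_ b1
      rw [← hC2]; exact (by linarith : _ ≤ dot u (I t) - dot u p).trans (le_abs_self _)
    · have hpos : dot u z - dot u (p + σ • u) < 0 := by linarith
      refine F.mem_actionBall hR hr hε hz hzr hqL hqB
        (lam := (dot u (I t) - dot u (p + σ • u)) / (dot u z - dot u (p + σ • u)))
        (div_nonneg_of_nonpos (by linarith) hpos.le)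
        ((div_le_one_of_neg hpos).2 (by linarith)) (div_mul_cancel₀ _ hpos.ne).symm ?_ b1
      rw [← hC2]; exact (by linarith : _ ≤ -(dot u (I t) - dot u (p + σ • u))).trans (neg_le_abs _)
  have hderiv : ∀ t ∈ Icc 0 (T / ε), (∀ s ∈ Icc 0 t, 0 ≤ m s) →
      (∀ s ∈ Icc 0 t, HasDerivWithinAt θ (gradVec (H1 (I s))) (Icc 0 t) s) ∧
      ∀ s ∈ Icc 0 t, HasDerivWithinAt I (-(ε • gradVec (F1 (θ s)))) (Icc 0 t) s := by
    intro t ht hm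
    have hsub : Icc 0 t ⊆ Icc 0 (T / ε) := Icc_subset_Icc_right ht.2
    refine ⟨fun s hs => ?_, fun s hs => (hI s (hsub hs)).mono hsub⟩
    have := (hθ s (hsub hs)).mono hsub
    rwa [clamp_eq hR.le (hball s (hm s hs))] at this
  have himp : ∀ t ∈ Icc 0 (T / ε), (∀ s ∈ Icc 0 t, 0 ≤ m s) → |offset k a N (I t)| ≤ 4 * M * ε ∧
      dot u (I 0) + ε * lam / 2 * t - 2 * M ^ 4 * ε ≤ dot u (I t) := by
    intro t ht hm
    obtain ⟨d1, d2⟩ := hderiv t ht hm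
    refine drift_in_box F hh hf hfC.2 hp hσ hseg he hu (fun J hJ => hwM.trans (hk' J hJ)) hlamF hε
      hε2 hε3 hT0 ht.1 ((le_div_iff₀ hε).1 ht.2) d1 d2 (fun s hs => hball s (hm s hs)) hI0seg
      (by rw [hθ0, hs₀]) (by rw [hθ0, dot_add, dot_smul, F.dot_k, mul_zero, add_zero]) ?_
    intro s hs
    obtain ⟨b1, b2, b3⟩ := hbox s (hm s hs)
    exact ⟨b1, by linarith, by linarith⟩
  have hm0 : 0 < m 0 := by
    refine lt_min ?_ (lt_min ?_ ?_)
    · rw [hoff0, abs_zero]; have : 0 < 8 * M * ε := by positivity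
      linarith
    · linarith
    · rw [hxq, hxI0]; linarith
  have hC1M : 2 * M ^ 4 * ε + C2 * ε + ε = C1 * ε := by rw [hC1]; ring
  have hex : ∃ t ∈ Icc 0 (T / ε), m t ≤ 0 := by
    by_contra hc
    push Not at hc
    have hmem : T / ε ∈ Icc 0 (T / ε) := ⟨hT', le_rfl⟩
    have h1 := (himp _ hmem (fun s hs => (hc s hs).le)).2
    have h2 := (hbox _ (hc _ hmem).le).2.2
    have h3 : ε * lam / 2 * (T / ε) = σ * N := by rw [hT]; field_simp
    rw [h3, hxI0] at h1
    linarith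
  obtain ⟨τ, hτ, hmτ, hpos⟩ := exists_first_zero hmcont hm0 hex
  obtain ⟨i1, i2⟩ := himp τ hτ hpos
  obtain ⟨b1, b2, b3⟩ := hbox τ hmτ.ge
  obtain ⟨d1, d2⟩ := hderiv τ hτ hpos
  have hdrift : 0 ≤ ε * lam / 2 * τ := mul_nonneg (by positivity) hτ.1
  have hreach : dot u (I τ) = dot u (p + σ • u) - C1 * ε := by
    refine le_antisymm b3 ?_
    by_contra hc
    push Not at hc
    have : 0 < m τ := by
      refine lt_min ?_ (lt_min ?_ ?_)
      · have : 0 < M * ε := by positivity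
        linarith
      · linarith
      · linarith
    linarith
  have hoff : ∀ t ∈ Icc 0 τ, ‖offset k a N (I t) • toPlane k‖ ≤ 8 * M ^ 2 * ε := by
    intro t ht
    rw [norm_smul, Real.norm_eq_abs]
    calc _ ≤ 8 * M * ε * M :=
          mul_le_mul (hbox t (hpos t ht)).1 F.norm_k (norm_nonneg _) (by positivity)
      _ = _ := by ring
  have hshift : ‖(C1 * ε / N) • u‖ ≤ C1 * M * ε := by
    rw [norm_smul, Real.norm_eq_abs, abs_of_pos (by positivity)]
    calc _ ≤ C1 * ε * M :=
          mul_le_mul (div_le_self hC1ε.le F.one_le) F.norm_u (norm_nonneg _) hC1ε.le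
      _ = _ := by ring
  have hpos1 : 0 ≤ C1 * M * ε := by positivity
  have hpos2 : 0 ≤ 8 * M ^ 2 * ε := by positivity
  refine ⟨τ, θ, I, hτ.1, ?_, isSolution_of_hasDerivWithinAt hR hh hf d1 d2
    (fun t ht => hball t (hpos t ht)), ?_, ?_, fun t ht => ?_⟩
  · refine hτ.2.trans (le_of_eq ?_)
    rw [hT, ← hN]; field_simp
  · rw [hI0, add_sub_cancel_left, add_mul]; linarith
  · have h1 := F.eq_of_mem_line hqL (I τ)
    have h2 : I τ - (p + σ • u) = -((C1 * ε / N) • u) + offset k a N (I τ) • toPlane k := by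
      rw [sub_eq_iff_eq_add']
      conv_lhs => rw [h1, hreach]
      rw [add_assoc, ← neg_smul]
      congr 3
      ring
    rw [h2]
    refine (norm_add_le _ _).trans ?_
    rw [norm_neg]
    linarith [hoff τ ⟨hτ.1, le_rfl⟩]
  · obtain ⟨c1, c2, c3⟩ := hbox t (hpos t ht)
    refine ⟨_, F.foot_mem_segment hσ hp (I := I t) (by linarith) (by linarith), ?_⟩
    rw [sub_sub_cancel]
    linarith [hoff t ht]

theorem exists_deriv_neg_of_periodic {φ D : ℝ → ℝ} (hφ : ∀ s, HasDerivAt φ (D s) s)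
    (hper : ∀ s, φ (s + 1) = φ s) {s₀ : ℝ} (h0 : D s₀ ≠ 0) : ∃ s, D s < 0 := by
  by_contra hc
  push Not at hc
  have hmono : Monotone φ := monotone_of_deriv_nonneg (fun s => (hφ s).differentiableAt)
    fun s => by rw [(hφ s).deriv]; exact hc s
  have hconst : φ =ᶠ[𝓝 s₀] fun _ => φ s₀ := by
    filter_upwards [Icc_mem_nhds (by linarith : s₀ - 1 < s₀) (by linarith : s₀ < s₀ + 1)] with s hs
    have h1 := hmono hs.1
    have h2 := hmono hs.2
    have h3 := hper (s₀ - 1)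
    rw [sub_add_cancel] at h3
    rw [hper] at h2
    linarith
  exact h0 ((hφ s₀).unique ((hasDerivAt_const s₀ (φ s₀)).congr_of_eventuallyEq hconst))

/-- `k` turned by a right angle. -/
def rightTurn (k : Fin 2 → ℤ) : Plane := toPlane ![k 1, -k 0]

theorem rightTurn_zero (k : Fin 2 → ℤ) : rightTurn k 0 = k 1 := by simp [rightTurn, toPlane]

theorem rightTurn_one (k : Fin 2 → ℤ) : rightTurn k 1 = -k 0 := by simp [rightTurn, toPlane]

theorem frame_rightTurn {k : Fin 2 → ℤ} (hk : k ≠ 0) {N : ℝ}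
    (hN : N = (k 0 : ℝ) ^ 2 + (k 1 : ℝ) ^ 2) : Frame k (rightTurn k) N (8 + N) :=
  exists_frame hk (s := 1) (by norm_num) (by rw [rightTurn_zero, one_mul])
    (by rw [rightTurn_one, one_mul]) hN le_rfl

theorem hasDerivAt_line {P : Plane → ℝ} {L : Plane →L[ℝ] ℝ} {x v : Plane} {s : ℝ}
    (h : HasFDerivAt P L (x + s • v)) : HasDerivAt (fun s : ℝ => P (x + s • v)) (L v) s := by
  have h1 : HasDerivAt (fun s : ℝ => x + s • v) v s := by
    simpa using ((hasDerivAt_id s).smul_const v).const_add x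
  exact h.comp_hasDerivAt s h1

theorem differentiable_kAverage {f : Plane → ℝ} {k : Fin 2 → ℤ} (hf : f ∈ unitBallTorus 19) :
    Differentiable ℝ (kAverage k f) := by
  have hj := hasJet_of_unitBallC (by norm_num) uniqueDiffOn_univ hf.1
  exact fun x => (hasFDerivAt_kAverage (fun x => (hj.d1 x (mem_univ x)).hasFDerivAt univ_mem)
    (jet_continuous hj).2.1 (fun x => hj.b1 x (mem_univ x)) x).differentiableAt

/-- The average of a nondegenerate perturbation has slopes of both signs. -/
theorem exists_slopes {k : Fin 2 → ℤ} (hk : k ≠ 0) {f : Plane → ℝ} (hf : f ∈ perturbations k 19) :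
    ∃ lam : ℝ, 0 < lam ∧ ∀ s : ℝ, s ^ 2 = 1 →
      ∃ θ : Plane, fderiv ℝ (kAverage k f) θ (s • rightTurn k) ≤ -lam := by
  obtain ⟨hf, θ₀, hθ₀⟩ := hf
  have hd := differentiable_kAverage (k := k) hf
  have F := frame_rightTurn hk rfl
  have hφ : ∀ s : ℝ, HasDerivAt (fun s : ℝ => kAverage k f (θ₀ + s • rightTurn k))
      (fderiv ℝ (kAverage k f) (θ₀ + s • rightTurn k) (rightTurn k)) s := fun s =>
    hasDerivAt_line (hd _).hasFDerivAt
  have hk0 : fderiv ℝ (kAverage k f) θ₀ (toPlane k) = 0 := by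
    have h1 := hasDerivAt_line (P := kAverage k f) (x := θ₀) (v := toPlane k) (s := 0)
      (hd _).hasFDerivAt
    simp only [kAverage_add_smul hf.2] at h1
    have h2 := h1.unique (hasDerivAt_const 0 _)
    simpa using h2
  have h0 : fderiv ℝ (kAverage k f) (θ₀ + (0 : ℝ) • rightTurn k) (rightTurn k) ≠ 0 := by
    rw [zero_smul, add_zero]
    intro hc
    refine hθ₀ (ContinuousLinearMap.ext fun v => ?_)
    rw [F.decomp v, map_add, map_smul, map_smul, hc, hk0]
    simp
  have hper : ∀ s : ℝ, kAverage k f (θ₀ + (s + 1) • rightTurn k)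
      = kAverage k f (θ₀ + s • rightTurn k) := fun s => by
    rw [add_smul, one_smul, ← add_assoc]
    exact kAverage_add_int hf.2 _ _
  obtain ⟨s₁, hs₁⟩ := exists_deriv_neg_of_periodic hφ hper h0
  obtain ⟨s₂, hs₂⟩ := exists_deriv_neg_of_periodic (fun s => (hφ s).neg)
    (fun s => by simp only [Pi.neg_apply, hper]) (neg_ne_zero.2 h0)
  refine ⟨min _ _, lt_min (neg_pos.2 hs₁) (neg_pos.2 hs₂), fun s hs => ?_⟩
  rcases sq_eq_one_iff.1 hs with rfl | rfl
  · exact ⟨_, by rw [one_smul]; exact le_neg.1 (min_le_left _ _)⟩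
  · exact ⟨_, by rw [neg_one_smul, map_neg]; exact le_neg.1 (min_le_right _ _)⟩

theorem hasDerivWithinAt_segment {B : Set Plane} {h : Plane → ℝ} {H1 : Plane → Plane →L[ℝ] ℝ}
    (hh : ∀ x ∈ B, HasFDerivWithinAt h (H1 x) B x) {p v : Plane} (hseg : segment ℝ p (p + v) ⊆ B)
    {t : ℝ} (ht : t ∈ Icc (0 : ℝ) 1) :
    HasDerivWithinAt (fun t : ℝ => h (p + t • v)) (H1 (p + t • v) v) (Icc 0 1) t := by
  have hmem : MapsTo (fun t : ℝ => p + t • v) (Icc 0 1) B := fun s hs => hseg (by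
    rw [segment_eq_image']; exact ⟨s, hs, by simp⟩)
  have h1 : HasDerivAt (fun s : ℝ => p + s • v) v t := by
    simpa using ((hasDerivAt_id t).smul_const v).const_add p
  exact (hh _ (hmem ht)).comp_hasDerivWithinAt t h1.hasDerivWithinAt hmem

theorem deriv_eq_zero_of_const_on_segment {B : Set Plane} {h : Plane → ℝ}
    {H1 : Plane → Plane →L[ℝ] ℝ} (hh : ∀ x ∈ B, HasFDerivWithinAt h (H1 x) B x) {p v : Plane}
    (hseg : segment ℝ p (p + v) ⊆ B) {e : ℝ} (he : ∀ J ∈ segment ℝ p (p + v), h J = e) :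
    ∀ J ∈ segment ℝ p (p + v), H1 J v = 0 := by
  intro J hJ
  rw [segment_eq_image'] at hJ
  obtain ⟨t, ht, rfl⟩ := hJ
  simp only [add_sub_cancel_left]
  have hmem : ∀ s ∈ Icc (0 : ℝ) 1, h (p + s • v) = e := fun s hs => he _ (by
    rw [segment_eq_image']; exact ⟨s, hs, by simp⟩)
  have h1 := (hasDerivWithinAt_const t (Icc (0 : ℝ) 1) e).congr hmem (hmem t ht)
  exact (uniqueDiffOn_Icc zero_lt_one t ht).eq_deriv _ (hasDerivWithinAt_segment hh hseg ht) h1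

theorem const_on_segment_of_deriv_eq_zero {B : Set Plane} {h : Plane → ℝ}
    {H1 : Plane → Plane →L[ℝ] ℝ} (hh : ∀ x ∈ B, HasFDerivWithinAt h (H1 x) B x) {p v : Plane}
    (hseg : segment ℝ p (p + v) ⊆ B) (h0 : ∀ J ∈ segment ℝ p (p + v), H1 J v = 0) :
    ∀ J ∈ segment ℝ p (p + v), h J = h p := by
  intro J hJ
  rw [segment_eq_image'] at hJ
  obtain ⟨t, ht, rfl⟩ := hJ
  have h1 := (convex_Icc (0 : ℝ) 1).norm_image_sub_le_of_norm_hasDerivWithin_le (C := 0)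
    (fun s hs => hasDerivWithinAt_segment hh hseg hs)
    (fun s hs => by
      rw [h0 _ (by rw [segment_eq_image']; exact ⟨s, hs, by simp⟩), norm_zero])
    (left_mem_Icc.2 zero_le_one) ht
  rw [zero_mul, zero_smul, add_zero] at h1
  rw [add_sub_cancel_left]
  exact sub_eq_zero.1 (norm_le_zero_iff.1 h1)

theorem norm_toPlane_le (k : Fin 2 → ℤ) : ‖toPlane k‖ ≤ (k 0 : ℝ) ^ 2 + (k 1 : ℝ) ^ 2 := by
  have hint : ∀ n : ℤ, |(n : ℝ)| ≤ (n : ℝ) ^ 2 := fun n => by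
    rw [← sq_abs]
    exact_mod_cast Int.le_self_sq |n|
  refine (pi_norm_le_iff_of_nonneg (by positivity)).2 fun i => ?_
  fin_cases i
  · exact (hint _).trans (le_add_of_nonneg_right (sq_nonneg _))
  · exact (hint _).trans (le_add_of_nonneg_left (sq_nonneg _))

theorem isSolution_zero {R : ℝ} {H : Plane → Plane → ℝ} {I₀ : Plane} (hI : I₀ ∈ actionBall R) :
    IsSolution R H 0 (fun _ => 0) (fun _ => I₀) := by
  refine ⟨fun _ _ => hI, fun t ht i => ?_, fun t ht i => ?_⟩ <;>
  · rw [Icc_self] at ht ⊢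
    rw [mem_singleton_iff.1 ht]
    exact HasFDerivWithinAt.singleton

/-- The case of an arbitrary resonant line. -/
theorem exists_drift_resonantLine (R : ℝ) (k : Fin 2 → ℤ) (a ℓ w : ℝ) (hR : 0 < R) (hk : k ≠ 0)
    (hw : 0 < w) :
    ∃ c : ℝ, 0 < c ∧
      ∀ f ∈ perturbations k 19, ∀ ρ : ℝ, 0 ≤ ρ →
      ∃ ε₀ δ : ℝ, 0 < ε₀ ∧ ε₀ ≤ 1 ∧ 0 < δ ∧
      ∀ (h : Plane → ℝ) (S Sstar : Set Plane),
        h ∈ unitBallC 10 (actionBall R) →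
        CondA1 R k a h S →
        CondA2 R h S Sstar →
        Metric.diam Sstar = ℓ →
        (∀ I ∈ Sstar, w ≤ ‖grad R h I‖) →
        (Sstar ∩ interior (actionBall R)).Nonempty →
        ∀ I' ∈ Sstar, ∀ I'' ∈ Sstar, dist I' I'' = ρ →
        ∀ ε : ℝ, 0 < ε → ε ≤ ε₀ →
        ∃ (τ : ℝ) (θ I : ℝ → Plane), 0 ≤ τ ∧ τ ≤ δ * ε⁻¹ ∧
          IsSolution R (perturbed h f ε) τ θ I ∧
          ‖I 0 - I'‖ ≤ c * ε ∧ ‖I τ - I''‖ ≤ c * ε ∧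
          ∀ t ∈ Icc 0 τ, Metric.infDist (I t) Sstar ≤ c * ε := by
  by_cases hex : ∃ z ∈ resonantLine k a, z ∈ interior (actionBall R)
  swap
  · refine ⟨1, one_pos, fun f _ ρ _ => ⟨1, 1, one_pos, le_rfl, one_pos, ?_⟩⟩
    rintro h S Sstar - hA1 hA2 - - ⟨z, hz, hzi⟩
    exact absurd ⟨z, (hA1.2.2.1 (hA2.2.1 hz)).1, hzi⟩ hex
  obtain ⟨z, hz, hzi⟩ := hex
  obtain ⟨c, hc, core⟩ := exists_drifting_orbit hR hk hw hz hzi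
  refine ⟨c, hc, fun f hf ρ hρ => ?_⟩
  rcases hρ.eq_or_lt with rfl | hρ
  · refine ⟨1, 1, one_pos, le_rfl, one_pos, ?_⟩
    intro h S Sstar _ hA1 hA2 _ _ _ I' hI' I'' _ hd ε hε _
    obtain rfl := dist_eq_zero.1 hd
    have hcε : 0 ≤ c * ε := by positivity
    refine ⟨0, fun _ => 0, fun _ => I', le_rfl, by positivity,
      isSolution_zero (hA1.2.2.1 (hA2.2.1 hI')).2, by simpa, by simpa, fun t _ => ?_⟩
    rw [Metric.infDist_zero_of_mem hI']
    exact hcε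
  obtain ⟨N, hN⟩ : ∃ N : ℝ, N = (k 0 : ℝ) ^ 2 + (k 1 : ℝ) ^ 2 := ⟨_, rfl⟩
  have F := frame_rightTurn hk hN
  have hN0 : 0 < N := zero_lt_one.trans_le F.one_le
  obtain ⟨lam, hlam, hslope⟩ := exists_slopes hk hf
  have hu0 : rightTurn k ≠ 0 := by
    intro hc
    have := F.dot_self
    rw [hc] at this
    simp [dot] at this
    linarith
  have hκ : 0 < ‖rightTurn k‖ := norm_pos_iff.2 hu0
  obtain ⟨σ, hσ⟩ : ∃ σ : ℝ, σ = ρ / ‖rightTurn k‖ := ⟨_, rfl⟩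
  have hσ0 : 0 < σ := by rw [hσ]; positivity
  obtain ⟨ε₀, hε₀, hε₁, core⟩ := core lam σ hlam hσ0
  refine ⟨ε₀, 2 * N * σ * lam⁻¹, hε₀, hε₁, by positivity, ?_⟩
  intro h S Sstar hh hA1 hA2 _ hgrad _ p hp q hq hd ε hε hεle
  have hsub : Sstar ⊆ resonantLine k a ∩ actionBall R := hA2.2.1.trans hA1.2.2.1
  have hj := hasJet_of_unitBallC (by norm_num) (uniqueDiffOn_actionBall hR) hh
  have hconv : Convex ℝ Sstar := by
    obtain ⟨x, y, -, hxy⟩ := hA2.1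
    rw [hxy]; exact convex_segment x y
  obtain ⟨d, hdef⟩ : ∃ d : ℝ, d = (dot (rightTurn k) q - dot (rightTurn k) p) / N := ⟨_, rfl⟩
  have hqp : q = p + d • rightTurn k := by
    have := F.eq_of_mem_line (hsub hp).1 q
    rwa [Frame.offset_eq_zero (hsub hq).1, zero_smul, add_zero, ← hdef] at this
  have hdσ : |d| = σ := by
    rw [hσ, ← hd, dist_comm, dist_eq_norm, hqp, add_sub_cancel_left, norm_smul, Real.norm_eq_abs]
    field_simp
  obtain ⟨s, hs, hds⟩ : ∃ s : ℝ, s ^ 2 = 1 ∧ d = σ * s := by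
    rcases abs_choice d with h1 | h1
    · exact ⟨1, by norm_num, by rw [mul_one, ← hdσ, h1]⟩
    · exact ⟨-1, by norm_num, by rw [← hdσ, h1]; ring⟩
  have hq' : p + σ • (s • rightTurn k) = q := by rw [smul_smul, ← hds, hqp]
  have hsegS : segment ℝ p q ⊆ Sstar := hconv.segment_subset hp hq
  obtain ⟨e, he⟩ := hA1.2.2.2
  have hconst : ∀ J ∈ segment ℝ p q, h J = e := fun J hJ => he J (hA2.2.1 (hsegS hJ))
  obtain ⟨θs, hθs⟩ := hslope s hs
  have hu : ∀ J ∈ segment ℝ p q, fderivWithin ℝ h (actionBall R) J (s • rightTurn k) = 0 := by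
    intro J hJ
    have := deriv_eq_zero_of_const_on_segment hj.d1 (p := p) (v := σ • (s • rightTurn k)) (e := e)
      (by rw [hq']; exact hsegS.trans (hsub.trans inter_subset_right)) (by rwa [hq']) J (by rwa [hq'])
    rw [map_smul, smul_eq_mul] at this
    exact (mul_eq_zero.1 this).resolve_left hσ0.ne'
  have hwk : ∀ J ∈ segment ℝ p q, w ≤ |fderivWithin ℝ h (actionBall R) J (toPlane k)| := by
    intro J hJ
    have hs0 : s ≠ 0 := by rintro rfl; norm_num at hs
    have hu' : fderivWithin ℝ h (actionBall R) J (rightTurn k) = 0 := by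
      have := hu J hJ
      rw [map_smul, smul_eq_mul] at this
      exact (mul_eq_zero.1 this).resolve_left hs0
    refine (hgrad J (hsegS hJ)).trans ?_
    have h1 := F.decomp (gradVec (fderivWithin ℝ h (actionBall R) J))
    rw [dot_gradVec, dot_gradVec, hu', zero_div, zero_smul, zero_add] at h1
    change ‖gradVec (fderivWithin ℝ h (actionBall R) J)‖ ≤ _
    rw [h1, norm_smul, Real.norm_eq_abs, abs_div, abs_of_pos hN0, div_mul_eq_mul_div, div_le_iff₀ hN0]
    exact mul_le_mul_of_nonneg_left (hN ▸ norm_toPlane_le k) (abs_nonneg _)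
  obtain ⟨τ, θ, I, hτ, hτle, hsol, hI0, hIτ, hnear⟩ := core h f (s • rightTurn k) p s hh hf.1 hs
    (by simp [rightTurn_zero]) (by simp [rightTurn_one]) (hsub hp).1 (hsub hp).2
    (by rw [hq']; exact (hsub hq).2) ⟨e, by rwa [hq']⟩ (by rwa [hq']) (by rwa [hq']) θs hθs ε hε hεle
  rw [hq'] at hIτ hnear
  refine ⟨τ, θ, I, hτ, by rwa [hN], hsol, hI0, hIτ, fun t ht => ?_⟩
  obtain ⟨J, hJ, hIJ⟩ := hnear t ht
  exact (Metric.infDist_le_dist_of_mem (hsegS hJ)).trans (by rwa [dist_eq_norm])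

theorem deriv_avgSecond {f : Plane → ℝ} (hf : f ∈ unitBallTorus 19) (x : ℝ) :
    deriv (avgSecond f) x = fderiv ℝ (kAverage ![0, 1] f) ![x, 0] ![1, 0] := by
  have hd := differentiable_kAverage (k := ![0, 1]) hf
  have hline : ∀ y : ℝ, (0 : Plane) + y • ![(1 : ℝ), 0] = ![y, 0] := fun y => by
    ext i; fin_cases i <;> simp
  have h1 := hasDerivAt_line (P := kAverage ![0, 1] f) (x := 0) (v := ![1, 0]) (s := x)
    (hd _).hasFDerivAt
  simp only [hline] at h1
  have h2 : avgSecond f = fun s : ℝ => kAverage ![0, 1] f ![s, 0] := by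
    funext s
    refine intervalIntegral.integral_congr fun t _ => ?_
    change f ![s, t] = f (![s, 0] + t • toPlane ![0, 1])
    congr 1
    ext i; fin_cases i <;> simp [toPlane]
  rw [h2, h1.deriv]

/-- The case of the line where the second action vanishes. -/
theorem exists_drift_secondAction_eq_zero (R ℓ w : ℝ) (hR : 0 < R) (hw : 0 < w) :
      ∃ c : ℝ, 0 < c ∧
      ∀ lam ρ : ℝ, 0 < lam → 0 ≤ ρ →
      ∃ ε₀ : ℝ, 0 < ε₀ ∧ ε₀ ≤ 1 ∧
      ∀ (h f : Plane → ℝ) (s₁ s₂ t₁ t₂ : ℝ),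
        h ∈ unitBallC 10 (actionBall R) →
        CondB1 R h s₁ s₂ →
        CondB2 R h s₁ s₂ t₁ t₂ w →
        t₂ - t₁ = ℓ →
        f ∈ unitBallTorus 19 →
        ∀ x' ∈ Icc t₁ t₂, ∀ x'' ∈ Icc t₁ t₂, |x' - x''| = ρ →
        ∀ θstar : ℝ, lam ≤ |deriv (avgSecond f) θstar| →
        deriv (avgSecond f) θstar * (x'' - x') ≤ 0 →
        ∀ ε : ℝ, 0 < ε → ε ≤ ε₀ →
        ∃ (τ : ℝ) (θ I : ℝ → Plane), 0 ≤ τ ∧ τ ≤ 2 * ρ * lam⁻¹ * ε⁻¹ ∧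
          IsSolution R (perturbed h f ε) τ θ I ∧
          |I 0 0 - x'| ≤ c * ε ∧ |I τ 0 - x''| ≤ c * ε ∧
          ∀ t ∈ Icc 0 τ,
            |I t 1| ≤ c * ε ∧ Metric.infDist (I t 0) (Icc t₁ t₂) ≤ c * ε := by
  have hk : (![0, 1] : Fin 2 → ℤ) ≠ 0 := fun hc => by simpa using congrFun hc 1
  have hz : (0 : Plane) ∈ resonantLine ![0, 1] 0 := by simp [resonantLine]
  have hzi : (0 : Plane) ∈ interior (actionBall R) :=
    mem_interior.2 ⟨Metric.ball 0 R, Metric.ball_subset_closedBall, Metric.isOpen_ball, by simpa⟩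
  obtain ⟨c, hc, core⟩ := exists_drifting_orbit hR hk hw hz hzi
  refine ⟨c, hc, fun lam ρ hlam hρ => ?_⟩
  have hline : ∀ (h : Plane → ℝ) (s₁ s₂ t₁ t₂ : ℝ), CondB1 R h s₁ s₂ → CondB2 R h s₁ s₂ t₁ t₂ w →
      ∀ x ∈ Icc t₁ t₂, (![x, 0] : Plane) ∈ actionBall R := by
    intro h s₁ s₂ t₁ t₂ hB1 hB2 x hx
    rw [mem_actionBall_iff hR.le]
    have := hB1.2.1 (hB2.2.1 hx)
    intro i
    fin_cases i
    · simpa [abs_le] using this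
    · simpa using hR.le
  rcases hρ.eq_or_lt with rfl | hρ
  · refine ⟨1, one_pos, le_rfl, ?_⟩
    intro h f s₁ s₂ t₁ t₂ _ hB1 hB2 _ _ x' hx' x'' _ hd _ _ _ ε hε _
    obtain rfl : x' = x'' := sub_eq_zero.1 (abs_eq_zero.1 hd)
    have hcε : 0 ≤ c * ε := by positivity
    refine ⟨0, fun _ => 0, fun _ => ![x', 0], le_rfl, by simp,
      isSolution_zero (hline h s₁ s₂ t₁ t₂ hB1 hB2 x' hx'), by simpa, by simpa, fun t _ => ?_⟩
    refine ⟨by simpa, ?_⟩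
    change Metric.infDist x' _ ≤ _
    rw [Metric.infDist_zero_of_mem hx']
    exact hcε
  obtain ⟨ε₀, hε₀, hε₁, core⟩ := core lam ρ hlam hρ
  refine ⟨ε₀, hε₀, hε₁, ?_⟩
  intro h f s₁ s₂ t₁ t₂ hh hB1 hB2 _ hf x' hx' x'' hx'' hd θs hθs hsign ε hε hεle
  have hj := hasJet_of_unitBallC (by norm_num) (uniqueDiffOn_actionBall hR) hh
  obtain ⟨s, hs, hxs⟩ : ∃ s : ℝ, s ^ 2 = 1 ∧ x'' - x' = ρ * s := by
    rcases abs_choice (x' - x'') with h1 | h1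
    · exact ⟨-1, by norm_num, by rw [← hd, h1]; ring⟩
    · exact ⟨1, by norm_num, by rw [← hd, h1]; ring⟩
  have hq : (![x', 0] : Plane) + ρ • (s • ![(1 : ℝ), 0]) = ![x'', 0] := by
    ext i; fin_cases i
    · simp; linarith
    · simp
  have hseg : ∀ J ∈ segment ℝ (![x', 0] : Plane) ![x'', 0], ∃ x ∈ Icc t₁ t₂, J = ![x, 0] := by
    rintro J ⟨α, β, hα, hβ, hαβ, rfl⟩
    refine ⟨α • x' + β • x'', convex_Icc t₁ t₂ hx' hx'' hα hβ hαβ, ?_⟩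
    ext i; fin_cases i <;> simp
  have hu : ∀ J ∈ segment ℝ (![x', 0] : Plane) ![x'', 0],
      fderivWithin ℝ h (actionBall R) J ![1, 0] = 0 := by
    intro J hJ
    obtain ⟨x, hx, rfl⟩ := hseg J hJ
    have h1 : (![1, 0] : Plane) = Pi.single 0 1 := by ext i; fin_cases i <;> simp
    rw [h1]
    exact hB1.2.2 x (hB2.2.1 hx)
  have hu' : ∀ v : ℝ, ∀ J ∈ segment ℝ (![x', 0] : Plane) ![x'', 0],
      fderivWithin ℝ h (actionBall R) J (v • ![1, 0]) = 0 := fun v J hJ => by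
    rw [map_smul, hu J hJ, smul_zero]
  have hsegB : segment ℝ (![x', 0] : Plane) ![x'', 0] ⊆ actionBall R :=
    (convex_actionBall R).segment_subset (hline h s₁ s₂ t₁ t₂ hB1 hB2 x' hx')
      (hline h s₁ s₂ t₁ t₂ hB1 hB2 x'' hx'')
  have hconst : ∀ J ∈ segment ℝ (![x', 0] : Plane) ![x'', 0], h J = h ![x', 0] := by
    have := const_on_segment_of_deriv_eq_zero hj.d1 (p := ![x', 0]) (v := ρ • (s • ![(1 : ℝ), 0]))
      (by rwa [hq]) (by rw [hq, smul_smul]; exact hu' _)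
    rwa [hq] at this
  have hwk : ∀ J ∈ segment ℝ (![x', 0] : Plane) ![x'', 0],
      w ≤ |fderivWithin ℝ h (actionBall R) J (toPlane ![0, 1])| := by
    intro J hJ
    obtain ⟨x, hx, rfl⟩ := hseg J hJ
    have h1 : toPlane ![0, 1] = Pi.single 1 1 := by ext i; fin_cases i <;> simp [toPlane]
    rw [h1]
    exact (hB2.2.2 x hx).trans (le_abs_self _)
  have hslope : fderiv ℝ (kAverage ![0, 1] f) ![θs, 0] (s • ![(1 : ℝ), 0]) ≤ -lam := by
    rw [map_smul, ← deriv_avgSecond hf, smul_eq_mul]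
    have h1 : |s * deriv (avgSecond f) θs| = |deriv (avgSecond f) θs| := by
      rw [abs_mul, (sq_eq_sq_iff_abs_eq_abs s 1).1 (hs.trans (one_pow 2).symm), abs_one, one_mul]
    have h2 : s * deriv (avgSecond f) θs ≤ 0 := by
      rw [hxs] at hsign
      by_contra hc
      push Not at hc
      have := mul_pos hρ hc
      linarith
    rw [← h1, abs_of_nonpos h2] at hθs
    linarith
  obtain ⟨τ, θ, I, hτ, hτle, hsol, hI0, hIτ, hnear⟩ := core h f (s • ![(1 : ℝ), 0]) ![x', 0] s hh hf hs
    (by simp) (by simp) (by simp [resonantLine]) (hline h s₁ s₂ t₁ t₂ hB1 hB2 x' hx')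
    (by rw [hq]; exact hline h s₁ s₂ t₁ t₂ hB1 hB2 x'' hx'') ⟨_, by rw [hq]; exact hconst⟩
    (by rw [hq]; exact hu' s) (by rw [hq]; exact hwk) ![θs, 0] hslope ε hε hεle
  rw [hq] at hIτ hnear
  refine ⟨τ, θ, I, hτ, by simpa using hτle, hsol, (norm_le_pi_norm (I 0 - ![x', 0]) 0).trans hI0,
    (norm_le_pi_norm (I τ - ![x'', 0]) 0).trans hIτ, fun t ht => ?_⟩
  obtain ⟨J, hJ, hIJ⟩ := hnear t ht
  obtain ⟨x, hx, rfl⟩ := hseg J hJ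
  refine ⟨?_, (Metric.infDist_le_dist_of_mem hx).trans ?_⟩
  · simpa using (norm_le_pi_norm (I t - ![x, 0]) 1).trans hIJ
  · exact (norm_le_pi_norm (I t - ![x, 0]) 0).trans hIJ

end FastDrift

theorem mainTheorem2 :
    -- the statement for an arbitrary resonant line
    (∀ (R : ℝ) (k : Fin 2 → ℤ) (a ℓ w : ℝ), 0 < R → k ≠ 0 → 0 < ℓ → 0 < w →
      ∃ c : ℝ, 0 < c ∧
      ∀ f ∈ FastDrift.perturbations k 19, ∀ ρ : ℝ, 0 ≤ ρ →
      ∃ ε₀ δ : ℝ, 0 < ε₀ ∧ ε₀ ≤ 1 ∧ 0 < δ ∧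
      ∀ (h : FastDrift.Plane → ℝ) (S Sstar : Set FastDrift.Plane),
        h ∈ FastDrift.unitBallC 10 (FastDrift.actionBall R) →
        FastDrift.CondA1 R k a h S →
        FastDrift.CondA2 R h S Sstar →
        Metric.diam Sstar = ℓ →
        (∀ I ∈ Sstar, w ≤ ‖FastDrift.grad R h I‖) →
        (Sstar ∩ interior (FastDrift.actionBall R)).Nonempty →
        ∀ I' ∈ Sstar, ∀ I'' ∈ Sstar, dist I' I'' = ρ →
        ∀ ε : ℝ, 0 < ε → ε ≤ ε₀ →
        ∃ (τ : ℝ) (θ I : ℝ → FastDrift.Plane), 0 ≤ τ ∧ τ ≤ δ * ε⁻¹ ∧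
          FastDrift.IsSolution R (FastDrift.perturbed h f ε) τ θ I ∧
          ‖I 0 - I'‖ ≤ c * ε ∧ ‖I τ - I''‖ ≤ c * ε ∧
          ∀ t ∈ Set.Icc 0 τ, Metric.infDist (I t) Sstar ≤ c * ε) ∧
    -- the quantitative statement for the line where the second action vanishes
    (∀ R ℓ w : ℝ, 0 < R → 0 < ℓ → 0 < w →
      ∃ c : ℝ, 0 < c ∧
      ∀ lam ρ : ℝ, 0 < lam → 0 ≤ ρ →
      ∃ ε₀ : ℝ, 0 < ε₀ ∧ ε₀ ≤ 1 ∧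
      ∀ (h f : FastDrift.Plane → ℝ) (s₁ s₂ t₁ t₂ : ℝ),
        h ∈ FastDrift.unitBallC 10 (FastDrift.actionBall R) →
        FastDrift.CondB1 R h s₁ s₂ →
        FastDrift.CondB2 R h s₁ s₂ t₁ t₂ w →
        t₂ - t₁ = ℓ →
        f ∈ FastDrift.unitBallTorus 19 →
        ∀ x' ∈ Set.Icc t₁ t₂, ∀ x'' ∈ Set.Icc t₁ t₂, |x' - x''| = ρ →
        ∀ θstar : ℝ, lam ≤ |deriv (FastDrift.avgSecond f) θstar| →
        deriv (FastDrift.avgSecond f) θstar * (x'' - x') ≤ 0 →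
        ∀ ε : ℝ, 0 < ε → ε ≤ ε₀ →
        ∃ (τ : ℝ) (θ I : ℝ → FastDrift.Plane), 0 ≤ τ ∧ τ ≤ 2 * ρ * lam⁻¹ * ε⁻¹ ∧
          FastDrift.IsSolution R (FastDrift.perturbed h f ε) τ θ I ∧
          |I 0 0 - x'| ≤ c * ε ∧ |I τ 0 - x''| ≤ c * ε ∧
          ∀ t ∈ Set.Icc 0 τ,
            |I t 1| ≤ c * ε ∧ Metric.infDist (I t 0) (Set.Icc t₁ t₂) ≤ c * ε) := by
  refine ⟨fun R k a ℓ w hR hk _ hw => ?_, fun R ℓ w hR _ hw => ?_⟩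
  · exact FastDrift.exists_drift_resonantLine R k a ℓ w hR hk hw
  · exact FastDrift.exists_drift_secondAction_eq_zero R ℓ w hR hw
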